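/- Let $E/\mathbb{Q}$ be a finite Galois extension with group $G=\mathrm{Gal}(E/\mathbb{Q})$. For each prime $p$ let $Q_p$ be a function with $Q_p(0)=1$ that is holomorphic on a branch cut of the open unit disk, save for a set $S_p$ of isolated singularities; that is, $Q_p$ is holomorphic on $\{|z|<1\}\setminus\Gamma_p$, where $\Gamma_p\supseteq S_p$ is the relatively closed set of cuts, $0\notin\Gamma_p$, and every point of $\Gamma_p$ has absolute value at least that of some point of $S_p$. Suppose that $p\mapsto Q_p$ is Frobenian with respect to $E/\mathbb{Q}$: there are a class function $c$ on $G$ and a finite set of primes $T$, containing those ramified in $E$, such that $Q_p=c(\mathrm{Fr}_p)$ for all $p\notin T$. Let $r$ be the smallest absolute value of an element of $\bigcup_p S_p$ (assumed attained), with $r=1$ if there are no singularities, and let $\mathcal{Q}(s)=\prod_p Q_p(p^{-s})$. For a representation $\rho:G\to\mathrm{GL}(V)$ let $L(s,\rho)=\prod_p\det(I-\rho(\mathrm{Fr}_p|V^{I_p})p^{-s})^{-1}$ be its Artin $L$-function on $\mathrm{Re}(s)>1$, and let $L(s,\rho)^{b}=\exp(b\log L(s,\rho))$, where $\log L(s,\rho)$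 is the holomorphic logarithm on $\mathrm{Re}(s)>1$ that tends to $0$ as $s\to+\infty$. (i) There are complex numbers $b_{n,\rho}$, indexed by the integers $n\ge1$ and the irreducible characters $\rho$ of $G$, such that for all but finitely many primes $p$ $$\log Q_p(z)=-\sum_{n\ge1}\sum_{\rho}b_{n,\rho}\log\det(I-\rho(\mathrm{Fr}_p)z^n)$$ as formal power series in $z$ (with $Q_p$ replaced by its Taylor series at $0$). (ii) For every family $(b_{n,\rho})$ as in (i) and every $\epsilon>0$, $$\mathcal{Q}(s)\prod_{p\le r^{-1/\epsilon}}Q_p(p^{-s})^{-1}\prod_{n\le1/\epsilon}\prod_\rho L(ns,\rho)^{-b_{n,\rho}}$$ is an absolutely convergent Dirichlet series (and so holomorphic) on $\mathrm{Re}(s)>\epsilon$. That is, there is a Dirichlet series $\sum_{m\ge1}a_m m^{-s}$ which converges absolutely and is holomorphic on $\mathrm{Re}(s)>\epsilon$, and which equals this expression for all $s$ with $\mathrm{Re}(s)>\max(1,\epsilon)$, where the products $\mathcal{Q}(s)$ and $L(ns,\rho)$ converge. Here the factors $Q_p(p^{-s})$ with $p\le r^{-1/\epsilon}$ are understood to be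 cancelled from $\mathcal{Q}(s)$, which agrees with the quotient wherever these factors are nonzero. -/

import Mathlib

open scoped NumberField Pointwise PowerSeries.WithPiTopology

noncomputable section

namespace FrobEuler

/-! ### Irreducible characters of a finite group -/

section IrreducibleCharacters

variable {G : Type*} [Group G]

/-- `χ` is the character of an irreducible finite-dimensional complex representation of `G`. -/
def IsIrredChar (χ : G → ℂ) : Prop :=
  ∃ (d : ℕ) (ρ : Representation ℂ G (Fin d → ℂ)), ρ.IsIrreducible ∧ ρ.character = χ

variable (G) in
/-- The set of irreducible complex characters of `G`. -/
abbrev IrrChar : Type _ := {χ : G → ℂ // IsIrredChar χ}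

/-- The degree of an irreducible character. -/
def IrrChar.deg (χ : IrrChar G) : ℕ := χ.2.choose

/-- An irreducible representation affording the irreducible character `χ`
(it is unique up to isomorphism when `G` is finite). -/
def IrrChar.rep (χ : IrrChar G) : Representation ℂ G (Fin χ.deg → ℂ) := χ.2.choose_spec.choose

theorem IrrChar.rep_irreducible (χ : IrrChar G) : χ.rep.IsIrreducible :=
  χ.2.choose_spec.choose_spec.1

theorem IrrChar.rep_character (χ : IrrChar G) : χ.rep.character = χ.1 :=
  χ.2.choose_spec.choose_spec.2

/-- A finite group has finitely many irreducible characters, since they are orthonormal. -/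
instance [Finite G] : Finite (IrrChar G) := by
  classical
  have := Fintype.ofFinite G
  have hc : (Nat.card G : ℂ) ≠ 0 := by simp
  have : Invertible (Nat.card G : ℂ) := invertibleOfNonzero hc
  have horth (χ ψ : IrrChar G) :
      (Nat.card G : ℂ)⁻¹ * ∑ g : G, χ.1 g * ψ.1 g⁻¹ = if χ = ψ then 1 else 0 := by
    have := χ.rep_irreducible
    have := ψ.rep_irreducible
    have h := Representation.char_orthonormal χ.rep ψ.rep
    rw [χ.rep_character, ψ.rep_character] at h
    rw [h]
    by_cases hχ : χ = ψ
    · subst hχ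
      rw [if_pos ⟨Representation.Equiv.refl _⟩, if_pos rfl]
    · rw [if_neg hχ, if_neg]
      rintro ⟨e⟩
      refine hχ (Subtype.ext ?_)
      rw [← χ.rep_character, ← ψ.rep_character, Representation.char_iso e]
  have hli : LinearIndependent ℂ (fun χ : IrrChar G => (χ.1 : G → ℂ)) := by
    rw [linearIndependent_iff']
    intro s c hs ψ hψ
    have h1 : ∑ χ ∈ s, c χ * ((Nat.card G : ℂ)⁻¹ * ∑ g : G, χ.1 g * ψ.1 g⁻¹) = 0 := by
      have h2 (g : G) : ∑ χ ∈ s, c χ * χ.1 g = 0 := by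
        simpa using congrFun hs g
      calc _ = (Nat.card G : ℂ)⁻¹ * ∑ g : G, (∑ χ ∈ s, c χ * χ.1 g) * ψ.1 g⁻¹ := by
            simp only [Finset.mul_sum, Finset.sum_mul]
            rw [Finset.sum_comm]
            refine Finset.sum_congr rfl fun g _ => Finset.sum_congr rfl fun χ _ => ?_
            ring
        _ = 0 := by simp [h2]
    simp only [horth] at h1
    simpa [hψ] using h1
  exact hli.finite

instance [Finite G] : Fintype (IrrChar G) := Fintype.ofFinite _

end IrreducibleCharacters

/-! ### Frobenius elements and Frobenian functions -/

section Frobenian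

/-- The polynomial `det (I - f z)` in the variable `z`, for an endomorphism `f` of a
finite-dimensional complex vector space. -/
def detOneSub {V : Type*} [AddCommGroup V] [Module ℂ V] [FiniteDimensional ℂ V]
    (f : V →ₗ[ℂ] V) : Polynomial ℂ :=
  (LinearMap.toMatrix (Module.finBasis ℂ V) (Module.finBasis ℂ V) f).charpolyRev

variable (E : Type*) [Field E] [NumberField E]

/-- `𝔓` is a prime of the ring of integers of `E` above the rational prime `p`. -/
def IsPrimeAbove (p : Nat.Primes) (𝔓 : Ideal (𝓞 E)) : Prop :=
  𝔓.IsPrime ∧ 𝔓.LiesOver (Ideal.span {((p : ℕ) : ℤ)})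

/-- `σ` belongs to the Frobenius class `Fr_p`: it is an (arithmetic) Frobenius element at some
prime of `E` above `p`. For `p` unramified in `E` such `σ` form one conjugacy class,
the image of `p` under the Artin map. -/
def IsFrobeniusOver (p : Nat.Primes) (σ : Gal(E/ℚ)) : Prop :=
  ∃ 𝔓 : Ideal (𝓞 E), IsPrimeAbove E p 𝔓 ∧ IsArithFrobAt ℤ σ 𝔓

/-- `f` is Frobenian with respect to `E/ℚ`: outside a finite set of primes containing the
ramified ones it is the composition of the Artin map with a class function. -/
def IsFrobenian {A : Type*} (f : Nat.Primes → A) : Prop :=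
  ∃ (T : Set Nat.Primes) (c : Gal(E/ℚ) → A), T.Finite ∧ (∀ g h, c (h * g * h⁻¹) = c g) ∧
    ∀ p ∉ T, Algebra.IsUnramifiedIn (𝓞 E) (Ideal.span {((p : ℕ) : ℤ)}) ∧
      ∀ σ, IsFrobeniusOver E p σ → f p = c σ

end Frobenian

/-! ### Artin `L`-functions -/

section Artin

variable (E : Type*) [Field E] [NumberField E]

theorem exists_prime_frobenius [IsGalois ℚ E] (p : Nat.Primes) :
    ∃ x : Ideal (𝓞 E) × Gal(E/ℚ), IsPrimeAbove E p x.1 ∧ IsArithFrobAt ℤ x.2 x.1 := by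
  have hp : (Ideal.span {((p : ℕ) : ℤ)}).IsPrime := by
    rw [Ideal.span_singleton_prime (by exact_mod_cast p.2.ne_zero)]
    exact Nat.prime_iff_prime_int.mp p.2
  obtain ⟨𝔓, h1, h2⟩ :=
    (inferInstance : Nonempty (Ideal.primesOver (Ideal.span {((p : ℕ) : ℤ)}) (𝓞 E)))
  have hne : 𝔓 ≠ ⊥ := Ideal.ne_bot_of_liesOver_of_ne_bot
    (p := Ideal.span {((p : ℕ) : ℤ)}) (by simpa using p.2.ne_zero) 𝔓
  have : Finite (𝓞 E ⧸ 𝔓) := Ring.HasFiniteQuotients.finiteQuotient hne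
  obtain ⟨σ, hσ⟩ := IsArithFrobAt.exists_of_isInvariant ℤ Gal(E/ℚ) 𝔓
  exact ⟨(𝔓, σ), ⟨h1, h2⟩, hσ⟩

variable [IsGalois ℚ E]

/-- A chosen prime of `E` above `p`. -/
def primeAbove (p : Nat.Primes) : Ideal (𝓞 E) := (exists_prime_frobenius E p).choose.1

/-- A Frobenius element at the chosen prime of `E` above `p`. -/
def frobAbove (p : Nat.Primes) : Gal(E/ℚ) := (exists_prime_frobenius E p).choose.2

theorem primeAbove_spec (p : Nat.Primes) : IsPrimeAbove E p (primeAbove E p) :=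
  (exists_prime_frobenius E p).choose_spec.1

theorem frobAbove_spec (p : Nat.Primes) : IsArithFrobAt ℤ (frobAbove E p) (primeAbove E p) :=
  (exists_prime_frobenius E p).choose_spec.2

variable {E} {V : Type*} [AddCommGroup V] [Module ℂ V]

/-- The subspace `V^{I_p}` of vectors fixed by the inertia group at the chosen prime above `p`. -/
def inertiaInvariants (ρ : Representation ℂ Gal(E/ℚ) V) (p : Nat.Primes) : Submodule ℂ V where
  carrier := {v | ∀ g ∈ (primeAbove E p).inertia Gal(E/ℚ), ρ g v = v}
  add_mem' hv hw g hg := by rw [map_add, hv g hg, hw g hg]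
  zero_mem' g _ := map_zero _
  smul_mem' c v hv g hg := by rw [map_smul, hv g hg]

theorem frob_mapsTo (ρ : Representation ℂ Gal(E/ℚ) V) (p : Nat.Primes) :
    ∀ v ∈ inertiaInvariants ρ p, ρ (frobAbove E p) v ∈ inertiaInvariants ρ p := by
  intro v hv g hg
  have := (primeAbove_spec E p).1
  have hst := IsArithFrobAt.mem_stabilizer (frobAbove_spec E p)
  have hst' : (frobAbove E p)⁻¹ • primeAbove E p = primeAbove E p := by
    rw [inv_smul_eq_iff]; exact (MulAction.mem_stabilizer_iff.mp hst).symm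
  have hn : (frobAbove E p)⁻¹ * g * frobAbove E p ∈ (primeAbove E p).inertia Gal(E/ℚ) := by
    intro x
    have h1 := Ideal.smul_mem_pointwise_smul (frobAbove E p)⁻¹ _ _ (hg (frobAbove E p • x))
    rw [hst', smul_sub, inv_smul_smul] at h1
    rwa [mul_smul, mul_smul]
  have h := hv _ hn
  calc ρ g (ρ (frobAbove E p) v)
      = ρ (frobAbove E p) (ρ ((frobAbove E p)⁻¹ * g * frobAbove E p) v) := by
        rw [← Module.End.mul_apply, ← Module.End.mul_apply, ← map_mul, ← map_mul]
        congr 2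
        group
    _ = ρ (frobAbove E p) v := by rw [h]

variable [FiniteDimensional ℂ V]

/-- The polynomial `det (I - ρ(Fr_p | V^{I_p}) z)`; it does not depend on the chosen
prime above `p` and the chosen Frobenius element. -/
def artinPoly (ρ : Representation ℂ Gal(E/ℚ) V) (p : Nat.Primes) : Polynomial ℂ :=
  detOneSub ((ρ (frobAbove E p)).restrict (frob_mapsTo ρ p))

/-- The Euler factor `det (I - ρ(Fr_p | V^{I_p}) p^{-s})⁻¹`. -/
def artinFactor (ρ : Representation ℂ Gal(E/ℚ) V) (p : Nat.Primes) (s : ℂ) : ℂ :=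
  ((artinPoly ρ p).eval ((p : ℂ) ^ (-s)))⁻¹

/-- The Artin `L`-function `L(s, ρ)` as an Euler product, for `Re s > 1`. -/
def artinL (ρ : Representation ℂ Gal(E/ℚ) V) (s : ℂ) : ℂ :=
  ∏' p : Nat.Primes, artinFactor ρ p s

/-- `ℓ` is the standard branch of `log L(s, ρ)` on `Re s > 1`: the holomorphic logarithm of the
convergent Euler product `L(s, ρ)` which tends to `0` as `s → +∞` along the reals.
On `Re s > 1` it is unique, and complex powers are `L(s, ρ)^b = exp (b ℓ(s))`. -/
structure IsLogArtinL (ρ : Representation ℂ Gal(E/ℚ) V) (ℓ : ℂ → ℂ) : Prop where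
  differentiableOn : DifferentiableOn ℂ ℓ {s | 1 < s.re}
  multipliable : ∀ s : ℂ, 1 < s.re → Multipliable fun p => artinFactor ρ p s
  exp_eq : ∀ s : ℂ, 1 < s.re → Complex.exp (ℓ s) = artinL ρ s
  tendsto : Filter.Tendsto (fun x : ℝ => ℓ x) Filter.atTop (nhds 0)

end Artin

/-! ### The Euler factors `Q_p` -/

/-- `f` is holomorphic on the cut open unit disk `{|z| < 1} \ Γ`, where `S` is the set of
(isolated) singularities and `Γ ⊇ S` is the relatively closed set of cuts. The cuts issue from
singularities and stay at least as far from `0`: no point of `Γ` is closer to `0`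
than all of `S`. The origin is not on a cut. -/
structure IsHolomorphicOnCutDisk (f : ℂ → ℂ) (S Γ : Set ℂ) : Prop where
  sing_subset : S ⊆ Γ
  cut_subset : Γ ⊆ Metric.ball 0 1
  zero_notMem : (0 : ℂ) ∉ Γ
  isolated : ∀ z ∈ Metric.ball (0 : ℂ) 1, ¬ AccPt z (Filter.principal S)
  isOpen_compl : IsOpen (Metric.ball (0 : ℂ) 1 \ Γ)
  outward : ∀ w ∈ Γ, ∃ a ∈ S, ‖a‖ ≤ ‖w‖
  differentiableOn : DifferentiableOn ℂ f (Metric.ball (0 : ℂ) 1 \ Γ)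

/-- The Taylor series of `f` at `0`, as a formal power series. -/
def taylorSeries (f : ℂ → ℂ) : PowerSeries ℂ :=
  PowerSeries.mk fun n => iteratedDeriv n f 0 / (n.factorial : ℂ)

theorem finite_primes_le (x : ℝ) : {p : Nat.Primes | ((p : ℕ) : ℝ) ≤ x}.Finite :=
  Set.Finite.of_finite_image (f := fun p : Nat.Primes => (p : ℕ))
    ((Set.finite_le_nat ⌊x⌋₊).subset (by rintro _ ⟨p, hp, rfl⟩; exact Nat.le_floor hp))
    Nat.Primes.coe_nat_injective.injOn

/-- The finite set of primes `p ≤ x`. -/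
def primesLE (x : ℝ) : Finset Nat.Primes := (finite_primes_le x).toFinset

theorem mem_primesLE {x : ℝ} {p : Nat.Primes} : p ∈ primesLE x ↔ ((p : ℕ) : ℝ) ≤ x := by
  rw [primesLE, Set.Finite.mem_toFinset, Set.mem_ofPred_eq]

/-- The family of coefficients `b n χ` (`n ≥ 1`, `χ` irreducible) satisfies, for all but finitely
many primes `p`, the identity of formal power series
`log Q_p(z) = - ∑_{n ≥ 1, χ} b n χ * log det (I - χ(Fr_p) z ^ n)`. -/
def IsLogDecomposition (E : Type*) [Field E] [NumberField E] (Q : Nat.Primes → ℂ → ℂ)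
    (b : ℕ → IrrChar Gal(E/ℚ) → ℂ) : Prop :=
  ∀ᶠ p : Nat.Primes in Filter.cofinite, ∀ σ : Gal(E/ℚ), IsFrobeniusOver E p σ →
    HasSum
      (fun i : ℕ+ × IrrChar Gal(E/ℚ) =>
        -(b i.1 i.2 • PowerSeries.logOf
          (((detOneSub (i.2.rep σ)).comp (Polynomial.X ^ (i.1 : ℕ)) : Polynomial ℂ) :
            PowerSeries ℂ)))
      (PowerSeries.logOf (taylorSeries (Q p)))

end FrobEuler

end

/-!
The power series `log det (I - χ(g) z ^ n)` starts with `-χ(g) z ^ n`, and the irreducible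
characters span the class functions. Hence the coefficients `b n χ` can be found by recursion on
`n`, expanding the degree `n` part of whatever the smaller indices leave over.

Multiplying `∏ p, Q p (p ^ (-s))` by `L(n s, χ) ^ (-b n χ)` for `n ≤ N = ⌊1 / ε⌋` changes the Euler
factor at almost every `p` into `F_p (p ^ (-s))` with `F_p(z) = 1 + O(z ^ (N + 1))`. Only finitely
many functions `F_p` occur up to finitely many primes, because there are finitely many Frobenius
classes, so the bound is uniform in `p` and the new Euler product converges absolutely as soon as
`(N + 1) Re s > 1`, in particular for `Re s > ε`. At every `p` the Taylor series of `F_p` converges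
at `p ^ (-s)`: for `p > r ^ (-1 / ε)` one has `p ^ (-ε) < r`, and the finitely many other `Q p` have
been removed.
-/

noncomputable section

namespace FrobEuler

section ClassFunctions

open MonoidAlgebra Representation

variable {G : Type*} [Group G]

theorem isIrreducible_of_equiv {k V W : Type*} [Field k] [AddCommGroup V] [Module k V]
    [AddCommGroup W] [Module k W] {ρ : Representation k G V} {σ : Representation k G W}
    [ρ.IsIrreducible] (e : ρ.Equiv σ) : σ.IsIrreducible := by
  rw [irreducible_iff_isSimpleModule_asModule]
  exact IsSimpleModule.congr
    (LinearEquiv.ofBijective (IntertwiningMap.equivLinearMapAsModule σ ρ e.symm.toIntertwiningMap)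
      e.symm.toLinearEquiv.bijective)

theorem asAlgebraHom_ofModule' (k M : Type*) [CommSemiring k] [AddCommMonoid M] [Module k M]
    [Module k[G] M] [IsScalarTower k k[G] M] :
    (ofModule' (k := k) (G := G) M).asAlgebraHom = Algebra.lsmul k k M :=
  (MonoidAlgebra.lift k (M →ₗ[k] M) G).apply_symm_apply _

theorem isIrreducible_ofModule' (k M : Type*) [Field k] [AddCommGroup M] [Module k M]
    [Module k[G] M] [IsScalarTower k k[G] M] [IsSimpleModule k[G] M] :
    (ofModule' (k := k) (G := G) M).IsIrreducible := by
  let e : (ofModule' (k := k) (G := G) M).asModule ≃ₗ[k[G]] M :=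
    { (ofModule' (k := k) (G := G) M).asModuleEquiv with
      map_smul' := fun x v => by simp [asAlgebraHom_ofModule'] }
  rw [irreducible_iff_isSimpleModule_asModule]
  exact IsSimpleModule.congr e

theorem isIrredChar_character {V : Type*} [AddCommGroup V] [Module ℂ V] [FiniteDimensional ℂ V]
    (ρ : Representation ℂ G V) [ρ.IsIrreducible] : IsIrredChar ρ.character := by
  let e : V ≃ₗ[ℂ] (Fin (Module.finrank ℂ V) → ℂ) := LinearEquiv.ofFinrankEq _ _ (by simp)
  let σ : Representation ℂ G (Fin (Module.finrank ℂ V) → ℂ) :=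
    ((e.conjAlgEquiv ℂ : Module.End ℂ V ≃ₐ[ℂ] _) : Module.End ℂ V →* _).comp ρ
  let φ : ρ.Equiv σ := .mk e fun g => by ext v; simp [σ]
  exact ⟨_, σ, isIrreducible_of_equiv φ, (char_iso φ).symm⟩

theorem IrrChar.apply_conj (χ : IrrChar G) (g h : G) : χ.1 (h * g * h⁻¹) = χ.1 g := by
  rw [← χ.rep_character, char_conj]

theorem IrrChar.orthonormal [Fintype G] [DecidableEq (IrrChar G)] (χ ψ : IrrChar G) :
    (Nat.card G : ℂ)⁻¹ * ∑ g : G, χ.1 g * ψ.1 g⁻¹ = if χ = ψ then 1 else 0 := by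
  classical
  have : Invertible (Nat.card G : ℂ) := invertibleOfNonzero (by simp)
  have := χ.rep_irreducible
  have := ψ.rep_irreducible
  rw [← χ.rep_character, ← ψ.rep_character, char_orthonormal]
  refine if_congr ⟨fun ⟨e⟩ => Subtype.ext ?_, ?_⟩ rfl rfl
  · rw [← χ.rep_character, ← ψ.rep_character, char_iso e]
  · rintro rfl
    exact ⟨.refl _⟩

/-- The element `∑ g, f g • g⁻¹` of the group algebra: it acts on a representation by a map with
trace `∑ g, f g * χ g⁻¹`, and it is central when `f` is a class function. -/
def invSum [Fintype G] (f : G → ℂ) : ℂ[G] := ∑ g, single g⁻¹ (f g)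

theorem invSum_mem_center [Fintype G] {f : G → ℂ} (hf : ∀ g h, f (h * g * h⁻¹) = f g) :
    invSum f ∈ Submonoid.center ℂ[G] := by
  refine Submonoid.mem_center_iff.2 fun x => ?_
  induction x using MonoidAlgebra.induction_linear with
  | zero => simp
  | add x y hx hy => rw [mul_add, add_mul, hx, hy]
  | single h a =>
    simp only [invSum, Finset.sum_mul, Finset.mul_sum, single_mul_single]
    refine Fintype.sum_equiv (MulAut.conj h).toEquiv _ _ fun g => ?_
    simp [← mul_assoc, hf, mul_comm a]

theorem trace_asAlgebraHom_invSum [Fintype G] {V : Type*} [AddCommGroup V] [Module ℂ V]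
    (ρ : Representation ℂ G V) (f : G → ℂ) :
    LinearMap.trace ℂ V (ρ.asAlgebraHom (invSum f)) = ∑ g, f g * ρ.character g⁻¹ := by
  simp [invSum, map_sum, asAlgebraHom_single, character]

theorem asAlgebraHom_invSum_eq_zero [Fintype G] {V : Type*} [AddCommGroup V] [Module ℂ V]
    [FiniteDimensional ℂ V] (ρ : Representation ℂ G V) [ρ.IsIrreducible] {f : G → ℂ}
    (hf : ∀ g h, f (h * g * h⁻¹) = f g) (h0 : ∑ g, f g * ρ.character g⁻¹ = 0) :
    ρ.asAlgebraHom (invSum f) = 0 := by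
  obtain ⟨c, hc⟩ := (IsIrreducible.algebraMap_intertwiningMap_bijective_of_isAlgClosed
    (ρ := ρ)).2 (IntertwiningMap.centralAlgebraMul (ρ := ρ) (invSum_mem_center hf))
  have hscalar : ρ.asAlgebraHom (invSum f) = c • LinearMap.id :=
    LinearMap.ext fun v => (DFunLike.congr_fun hc v).symm
  have : Nontrivial V := IsSimpleModule.nontrivial ℂ[G] ρ.asModule
  have hc0 : c = 0 := by
    simpa [← trace_asAlgebraHom_invSum, hscalar, Module.finrank_pos.ne'] using h0
  rw [hscalar, hc0, zero_smul]

theorem invSum_smul_eq_zero [Fintype G] {f : G → ℂ}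
    (hf : ∀ g h, f (h * g * h⁻¹) = f g) (h0 : ∀ χ : IrrChar G, ∑ g, f g * χ.1 g⁻¹ = 0)
    {M : Type*} [AddCommGroup M] [Module ℂ M] [Module ℂ[G] M] [IsScalarTower ℂ ℂ[G] M]
    [IsSimpleModule ℂ[G] M] (m : M) : invSum f • m = 0 := by
  have := isIrreducible_ofModule' (G := G) ℂ M
  have : FiniteDimensional ℂ M := Module.Finite.trans ℂ[G] M
  have h := asAlgebraHom_invSum_eq_zero (ofModule' M) hf
    (h0 ⟨_, isIrredChar_character (ofModule' M)⟩)
  simpa [asAlgebraHom_ofModule'] using DFunLike.congr_fun h m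

theorem eq_zero_of_orthogonal_irrChar [Fintype G] {f : G → ℂ}
    (hf : ∀ g h, f (h * g * h⁻¹) = f g) (h0 : ∀ χ : IrrChar G, ∑ g, f g * χ.1 g⁻¹ = 0) :
    f = 0 := by
  have : NeZero (Nat.card G : ℂ) := ⟨by simp⟩
  have hz : invSum f ∈ Module.jacobson ℂ[G] ℂ[G] := by
    refine Submodule.mem_sInf.2 fun I hI => ?_
    have : IsSimpleModule ℂ[G] (ℂ[G] ⧸ I) := isSimpleModule_iff_isCoatom.2 hI
    simpa [← Submodule.Quotient.mk_smul]
      using invSum_smul_eq_zero hf h0 (Submodule.Quotient.mk (p := I) 1)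
  rw [IsSemisimpleModule.jacobson_eq_bot, Submodule.mem_bot] at hz
  funext g
  classical
  simpa [invSum, MonoidAlgebra.coeff_sum, Finsupp.finsetSum_apply, Finsupp.single_apply]
    using congrArg (fun z : ℂ[G] => z.coeff g⁻¹) hz

/-- The coefficient of `χ` in the expansion of a class function `f` in irreducible characters. -/
def charCoeff [Fintype G] (f : G → ℂ) (χ : IrrChar G) : ℂ :=
  (Nat.card G : ℂ)⁻¹ * ∑ g, f g * χ.1 g⁻¹

theorem charCoeff_sum_mul [Fintype G] (b : IrrChar G → ℂ) :
    charCoeff (fun g => ∑ χ, b χ * χ.1 g) = b := by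
  classical
  funext ψ
  calc (Nat.card G : ℂ)⁻¹ * ∑ g, (∑ χ, b χ * χ.1 g) * ψ.1 g⁻¹
      = ∑ χ, b χ * ((Nat.card G : ℂ)⁻¹ * ∑ g, χ.1 g * ψ.1 g⁻¹) := by
        simp only [Finset.sum_mul, Finset.mul_sum]
        rw [Finset.sum_comm]
        exact Finset.sum_congr rfl fun χ _ => Finset.sum_congr rfl fun g _ => by ring
    _ = b ψ := by simp only [IrrChar.orthonormal, mul_ite, mul_one, mul_zero,
        Finset.sum_ite_eq', Finset.mem_univ, if_true]

theorem sum_charCoeff_mul [Fintype G] {f : G → ℂ} (hf : ∀ g h, f (h * g * h⁻¹) = f g) (g : G) :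
    ∑ χ, charCoeff f χ * χ.1 g = f g := by
  have hsub : (fun g => f g - ∑ χ, charCoeff f χ * χ.1 g) = 0 := by
    refine eq_zero_of_orthogonal_irrChar (fun g h => by simp only [hf, IrrChar.apply_conj])
      fun ψ => ?_
    have hψ := congrFun (charCoeff_sum_mul (charCoeff f)) ψ
    conv_rhs at hψ => rw [charCoeff]
    have hcard : (Nat.card G : ℂ)⁻¹ ≠ 0 := by simp
    simpa [sub_mul, sub_eq_zero] using (mul_left_cancel₀ hcard hψ).symm
  exact (sub_eq_zero.1 (congrFun hsub g)).symm

end ClassFunctions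

section FormalLogarithm

open PowerSeries

variable {A : Type*} [CommRing A] [Algebra ℚ A]

theorem exists_logOf_eq_sub_one_mul {f : A⟦X⟧} (hf : constantCoeff f = 1) :
    ∃ u : A⟦X⟧, constantCoeff u = 1 ∧ logOf f = (f - 1) * u := by
  have hs : HasSubst (f - 1) := .of_constantCoeff_zero' (by simp [hf])
  obtain ⟨v, hv⟩ : X ^ 2 ∣ log A - X := by
    refine X_pow_dvd_iff.2 fun m hm => ?_
    interval_cases m <;> simp [coeff_X, coeff_log]
  have hlog : log A = X * (1 + X * v) := by linear_combination hv
  refine ⟨1 + (f - 1) * v.subst (f - 1), by simp [hf], ?_⟩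
  rw [logOf_eq, hlog, ← coe_substAlgHom hs]
  simp only [map_mul, map_add, map_one, coe_substAlgHom, subst_X hs]

theorem X_pow_dvd_logOf_iff {f : A⟦X⟧} (hf : constantCoeff f = 1) {n : ℕ} :
    X ^ n ∣ logOf f ↔ X ^ n ∣ f - 1 := by
  obtain ⟨u, hu, h⟩ := exists_logOf_eq_sub_one_mul hf
  rw [h]
  exact (isUnit_iff_constantCoeff.2 (hu ▸ isUnit_one)).dvd_mul_right

theorem coeff_logOf_of_X_pow_dvd {f : A⟦X⟧} (hf : constantCoeff f = 1) {n : ℕ}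
    (hdvd : X ^ n ∣ f - 1) : coeff n (logOf f) = coeff n (f - 1) := by
  obtain ⟨u, hu, h⟩ := exists_logOf_eq_sub_one_mul hf
  obtain ⟨g, hg⟩ := hdvd
  rw [h, hg, mul_assoc, coeff_X_pow_mul', coeff_X_pow_mul']
  simp [hu]

theorem constantCoeff_comp_X_pow {R : Type*} [CommSemiring R] {P : Polynomial R}
    (hP : P.eval 0 = 1) {n : ℕ} (hn : n ≠ 0) :
    constantCoeff ((P.comp (Polynomial.X ^ n) : Polynomial R) : R⟦X⟧) = 1 := by
  simp [Polynomial.coeff_zero_eq_eval_zero, Polynomial.eval_comp, hn, hP]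

theorem X_pow_dvd_comp_X_pow_sub_one {R : Type*} [CommRing R] {P : Polynomial R}
    (hP : P.eval 0 = 1) (n : ℕ) :
    (X : R⟦X⟧) ^ n ∣ (P.comp (Polynomial.X ^ n) : Polynomial R) - 1 := by
  obtain ⟨S, hS⟩ : Polynomial.X ∣ P - 1 := by
    simp [Polynomial.X_dvd_iff, Polynomial.coeff_zero_eq_eval_zero, hP]
  refine ⟨(S.comp (Polynomial.X ^ n) : Polynomial R), ?_⟩
  rw [eq_add_of_sub_eq hS]
  simp

theorem coeff_logOf_comp_X_pow_self {P : Polynomial A} (hP : P.eval 0 = 1) {n : ℕ} (hn : n ≠ 0) :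
    coeff n (logOf ((P.comp (Polynomial.X ^ n) : Polynomial A) : A⟦X⟧)) = P.coeff 1 := by
  rw [coeff_logOf_of_X_pow_dvd (constantCoeff_comp_X_pow hP hn)
    (X_pow_dvd_comp_X_pow_sub_one hP n)]
  have := Polynomial.coeff_expand_mul (Nat.pos_of_ne_zero hn) P 1
  rw [one_mul, Polynomial.expand_eq_comp_X_pow] at this
  simpa [coeff_one, hn]

theorem derivative_logOf_mul {f : A⟦X⟧} (hf : constantCoeff f = 1) :
    d⁄dX A (logOf f) * f = d⁄dX A f := by
  have hs : HasSubst (f - 1) := .of_constantCoeff_zero' (by simp [hf])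
  have hlog : d⁄dX A (log A) * (1 + X) = 1 := by
    rw [deriv_log]
    ext n
    rw [mul_add, mul_one, map_add]
    cases n <;> simp [coeff_succ_mul_X, pow_succ, coeff_one]
  have hsubst := congrArg (substAlgHom hs) hlog
  rw [map_mul, map_add, map_one, coe_substAlgHom, subst_X hs, add_sub_cancel] at hsubst
  rw [logOf_eq, derivative_subst hs, mul_right_comm, hsubst]
  simp

end FormalLogarithm

section TaylorSeries

open Filter Topology PowerSeries

theorem coeff_taylorSeries (f : ℂ → ℂ) (n : ℕ) :
    coeff n (taylorSeries f) = iteratedDeriv n f 0 / (n.factorial : ℂ) := coeff_mk _ _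

theorem constantCoeff_taylorSeries (f : ℂ → ℂ) : constantCoeff (taylorSeries f) = f 0 := by
  simp [← coeff_zero_eq_constantCoeff_apply, coeff_taylorSeries]

theorem taylorSeries_congr {f g : ℂ → ℂ} (h : f =ᶠ[𝓝 0] g) : taylorSeries f = taylorSeries g := by
  ext n
  rw [coeff_taylorSeries, coeff_taylorSeries, h.iteratedDeriv_eq]

theorem taylorSeries_const_mul (c : ℂ) (f : ℂ → ℂ) :
    taylorSeries (fun z => c * f z) = c • taylorSeries f := by
  ext n
  rw [coeff_smul, coeff_taylorSeries, coeff_taylorSeries, iteratedDeriv_const_mul_field,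
    smul_eq_mul, mul_div_assoc]

theorem taylorSeries_add {f g : ℂ → ℂ} (hf : AnalyticAt ℂ f 0) (hg : AnalyticAt ℂ g 0) :
    taylorSeries (fun z => f z + g z) = taylorSeries f + taylorSeries g := by
  ext n
  rw [map_add, coeff_taylorSeries, coeff_taylorSeries, coeff_taylorSeries,
    iteratedDeriv_fun_add hf.contDiffAt hg.contDiffAt, add_div]

theorem taylorSeries_sum {ι : Type*} (s : Finset ι) {f : ι → ℂ → ℂ}
    (hf : ∀ i ∈ s, AnalyticAt ℂ (f i) 0) :
    taylorSeries (fun z => ∑ i ∈ s, f i z) = ∑ i ∈ s, taylorSeries (f i) := by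
  ext n
  simp only [map_sum, coeff_taylorSeries]
  rw [iteratedDeriv_fun_sum fun i hi => (hf i hi).contDiffAt, Finset.sum_div]

theorem taylorSeries_mul {f g : ℂ → ℂ} (hf : AnalyticAt ℂ f 0) (hg : AnalyticAt ℂ g 0) :
    taylorSeries (fun z => f z * g z) = taylorSeries f * taylorSeries g := by
  ext n
  rw [coeff_taylorSeries, iteratedDeriv_fun_mul hf.contDiffAt hg.contDiffAt, coeff_mul,
    Finset.Nat.sum_antidiagonal_eq_sum_range_succ_mk, Finset.sum_div]
  refine Finset.sum_congr rfl fun i hi => ?_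
  rw [coeff_taylorSeries, coeff_taylorSeries,
    Nat.cast_choose ℂ (Nat.lt_succ_iff.1 (Finset.mem_range.1 hi))]
  field_simp [Nat.factorial_ne_zero]

theorem taylorSeries_deriv (f : ℂ → ℂ) : taylorSeries (deriv f) = d⁄dX ℂ (taylorSeries f) := by
  ext n
  rw [coeff_derivative, coeff_taylorSeries, coeff_taylorSeries, iteratedDeriv_succ',
    Nat.factorial_succ]
  push_cast
  field_simp

theorem taylorSeries_eval (P : Polynomial ℂ) : taylorSeries (fun z => P.eval z) = P := by
  have hderiv (n : ℕ) : iteratedDeriv n (fun z => P.eval z) =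
      fun z => (Polynomial.derivative^[n] P).eval z := by
    induction n with
    | zero => simp
    | succ n ih =>
      funext z
      rw [iteratedDeriv_succ, ih, Polynomial.deriv, Function.iterate_succ_apply']
  ext n
  simp [coeff_taylorSeries, hderiv, ← Polynomial.coeff_zero_eq_eval_zero,
    Polynomial.coeff_iterate_derivative, Nat.descFactorial_self, Nat.factorial_ne_zero]

theorem derivative_taylorSeries_of_exp_eq {P L : ℂ → ℂ} (hL : AnalyticAt ℂ L 0)
    (h : (fun z => Complex.exp (L z)) =ᶠ[𝓝 0] P) :
    d⁄dX ℂ (taylorSeries P) = d⁄dX ℂ (taylorSeries L) * taylorSeries P := by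
  rw [← taylorSeries_deriv, ← taylorSeries_deriv,
    ← taylorSeries_mul hL.deriv (hL.cexp.congr h)]
  refine taylorSeries_congr ?_
  filter_upwards [h.deriv, h, hL.eventually_analyticAt] with z hderiv hz hLz
  rw [← hderiv, ← hz, mul_comm]
  exact hLz.differentiableAt.hasDerivAt.cexp.deriv

theorem logOf_taylorSeries {P L : ℂ → ℂ} (hL : AnalyticAt ℂ L 0) (hL0 : L 0 = 0)
    (h : (fun z => Complex.exp (L z)) =ᶠ[𝓝 0] P) : logOf (taylorSeries P) = taylorSeries L := by
  have hP : constantCoeff (taylorSeries P) = 1 := by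
    simp [constantCoeff_taylorSeries, ← h.self_of_nhds, hL0]
  have hP0 : taylorSeries P ≠ 0 := fun h0 => by simp [h0] at hP
  refine derivative.ext (mul_right_cancel₀ hP0 ?_) ?_
  · rw [derivative_logOf_mul hP, derivative_taylorSeries_of_exp_eq hL h]
  · rw [constantCoeff_logOf hP, constantCoeff_taylorSeries, hL0]

end TaylorSeries

section DetOneSub

open Polynomial Module.End

theorem reverse_prod_X_sub_C {R : Type*} [CommRing R] [IsDomain R] (s : Multiset R) :
    (s.map fun μ => X - C μ).prod.reverse = (s.map fun μ => 1 - C μ * X).prod := by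
  have hone : (1 : R[X]).reverse = 1 := by simpa using reverse_C (1 : R)
  induction s using Multiset.induction_on with
  | empty => simpa using hone
  | cons μ s ih =>
    have hμ : (X - C μ).reverse = 1 - C μ * X := by
      have hX : (X : R[X]).reverse = 1 := by simpa [hone] using reverse_mul_X (1 : R[X])
      rw [sub_eq_add_neg, ← C_neg, reverse_add_C, hX, natDegree_X, pow_one, C_neg, neg_mul,
        sub_eq_add_neg]
    simp [reverse_mul_of_domain, ih, hμ]

variable {V : Type*} [AddCommGroup V] [Module ℂ V] [FiniteDimensional ℂ V]

theorem detOneSub_eq_reverse_charpoly (f : V →ₗ[ℂ] V) : detOneSub f = f.charpoly.reverse := by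
  rw [detOneSub, ← Matrix.reverse_charpoly, LinearMap.charpoly_toMatrix]

theorem eval_zero_detOneSub (f : V →ₗ[ℂ] V) : (detOneSub f).eval 0 = 1 :=
  Matrix.eval_charpolyRev

theorem coeff_one_detOneSub (f : V →ₗ[ℂ] V) :
    (detOneSub f).coeff 1 = -LinearMap.trace ℂ V f := by
  rw [detOneSub, Matrix.coeff_charpolyRev_eq_neg_trace,
    LinearMap.trace_eq_matrix_trace ℂ (Module.finBasis ℂ V)]

theorem detOneSub_conj {W : Type*} [AddCommGroup W] [Module ℂ W] [FiniteDimensional ℂ W]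
    (e : V ≃ₗ[ℂ] W) (f : V →ₗ[ℂ] V) : detOneSub (e.conj f) = detOneSub f := by
  rw [detOneSub_eq_reverse_charpoly, detOneSub_eq_reverse_charpoly, LinearEquiv.charpoly_conj]

theorem detOneSub_apply_conj {G : Type*} [Group G] (ρ : Representation ℂ G V) (g h : G) :
    detOneSub (ρ (h * g * h⁻¹)) = detOneSub (ρ g) := by
  let e : V ≃ₗ[ℂ] V := .ofLinearMap (ρ h) (ρ h⁻¹)
    (by rw [← Module.End.mul_eq_comp, ← map_mul, mul_inv_cancel, map_one, Module.End.one_eq_id])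
    (by rw [← Module.End.mul_eq_comp, ← map_mul, inv_mul_cancel, map_one, Module.End.one_eq_id])
  rw [← detOneSub_conj e (ρ g), map_mul, map_mul]
  rfl

theorem eval_detOneSub (f : V →ₗ[ℂ] V) (z : ℂ) :
    (detOneSub f).eval z = (f.charpoly.roots.map fun μ => 1 - μ * z).prod := by
  rw [detOneSub_eq_reverse_charpoly,
    (IsAlgClosed.splits f.charpoly).eq_prod_roots_of_monic f.charpoly_monic,
    reverse_prod_X_sub_C, eval_multiset_prod, Multiset.map_map, roots_multiset_prod_X_sub_C]
  simp

theorem card_roots_charpoly (f : V →ₗ[ℂ] V) :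
    Multiset.card f.charpoly.roots = Module.finrank ℂ V := by
  rw [← (IsAlgClosed.splits f.charpoly).natDegree_eq_card_roots, LinearMap.charpoly_natDegree]

theorem norm_eq_one_of_mem_roots_charpoly {f : V →ₗ[ℂ] V} {m : ℕ} (hm : m ≠ 0) (hf : f ^ m = 1)
    {μ : ℂ} (hμ : μ ∈ f.charpoly.roots) : ‖μ‖ = 1 := by
  obtain ⟨v, hv⟩ :=
    ((hasEigenvalue_iff_isRoot_charpoly f μ).2 (isRoot_of_mem_roots hμ)).exists_hasEigenvector
  have hpow : (μ ^ m - 1) • v = 0 := by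
    rw [sub_smul, ← hv.pow_apply, hf, one_smul, Module.End.one_apply, sub_self]
  exact Complex.norm_eq_one_of_pow_eq_one
    (sub_eq_zero.1 ((smul_eq_zero.1 hpow).resolve_right hv.2)) hm

/-- The branch of `log det (I - f z)` given by the principal logarithms of the factors `1 - μ z`,
where `μ` runs over the eigenvalues of `f`. When all `‖μ‖ ≤ 1` it is holomorphic on the open unit
disk. -/
def logDet (f : V →ₗ[ℂ] V) (z : ℂ) : ℂ :=
  (f.charpoly.roots.map fun μ => Complex.log (1 - μ * z)).sum

theorem logDet_zero (f : V →ₗ[ℂ] V) : logDet f 0 = 0 := by simp [logDet]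

theorem logDet_conj {W : Type*} [AddCommGroup W] [Module ℂ W] [FiniteDimensional ℂ W]
    (e : V ≃ₗ[ℂ] W) (f : V →ₗ[ℂ] V) : logDet (e.conj f) = logDet f := by
  funext z
  rw [logDet, logDet, LinearEquiv.charpoly_conj]

variable {f : V →ₗ[ℂ] V} (hf : ∀ μ ∈ f.charpoly.roots, ‖μ‖ ≤ 1)

theorem one_sub_mul_mem_slitPlane {μ z : ℂ} (hμ : ‖μ‖ ≤ 1) (hz : ‖z‖ < 1) :
    1 - μ * z ∈ Complex.slitPlane := by
  rw [sub_eq_add_neg]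
  refine Complex.mem_slitPlane_of_norm_lt_one ?_
  rw [norm_neg, norm_mul]
  exact (mul_le_of_le_one_left (norm_nonneg z) hμ).trans_lt hz

include hf

theorem differentiableOn_logDet : DifferentiableOn ℂ (logDet f) (Metric.ball 0 1) := by
  intro z hz
  refine DifferentiableAt.differentiableWithinAt ?_
  have hlog : ∀ μ ∈ f.charpoly.roots,
      DifferentiableAt ℂ (fun z => Complex.log (1 - μ * z)) z := fun μ hμ =>
    .clog (by fun_prop) (one_sub_mul_mem_slitPlane (hf μ hμ) (mem_ball_zero_iff.1 hz))
  unfold logDet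
  generalize f.charpoly.roots = s at hlog ⊢
  induction s using Multiset.induction_on with
  | empty => simp
  | cons μ s ih =>
    rw [Multiset.forall_mem_cons] at hlog
    simpa using hlog.1.fun_add (ih hlog.2)

theorem exp_logDet {z : ℂ} (hz : ‖z‖ < 1) :
    Complex.exp (logDet f z) = (detOneSub f).eval z := by
  rw [logDet, Complex.exp_multiset_sum, Multiset.map_map, eval_detOneSub]
  exact congrArg _ (Multiset.map_congr rfl fun μ hμ =>
    Complex.exp_log (Complex.slitPlane_ne_zero (one_sub_mul_mem_slitPlane (hf μ hμ) hz)))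

theorem norm_logDet_le {z : ℂ} (hz : ‖z‖ ≤ 1 / 2) :
    ‖logDet f z‖ ≤ Module.finrank ℂ V * (3 / 2 * ‖z‖) := by
  suffices hlog : ∀ x ∈ f.charpoly.roots.map fun μ => ‖Complex.log (1 - μ * z)‖,
      x ≤ 3 / 2 * ‖z‖ by
    have hsum := Multiset.sum_le_card_nsmul _ _ hlog
    rw [Multiset.card_map, card_roots_charpoly, nsmul_eq_mul] at hsum
    refine (norm_multiset_sum_le _).trans ?_
    rwa [Multiset.map_map]
  intro x hx
  obtain ⟨μ, hμ, rfl⟩ := Multiset.mem_map.1 hx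
  have hle : ‖-(μ * z)‖ ≤ ‖z‖ := by
    rw [norm_neg, norm_mul]
    exact mul_le_of_le_one_left (norm_nonneg z) (hf μ hμ)
  rw [sub_eq_add_neg]
  exact (Complex.norm_log_one_add_half_le_self (hle.trans hz)).trans (by gcongr)

theorem taylorSeries_logDet_pow {n : ℕ} (hn : n ≠ 0) :
    taylorSeries (fun z => logDet f (z ^ n)) =
      PowerSeries.logOf (((detOneSub f).comp (X ^ n) : ℂ[X]) : PowerSeries ℂ) := by
  rw [← taylorSeries_eval]
  have hpow : AnalyticAt ℂ (fun z : ℂ => z ^ n) 0 := by fun_prop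
  refine (logOf_taylorSeries ?_ (by simp [hn, logDet_zero]) ?_).symm
  · exact ((differentiableOn_logDet hf).analyticAt (Metric.ball_mem_nhds 0 one_pos)).comp_of_eq
      hpow (zero_pow hn)
  · have hball : Metric.ball (0 : ℂ) 1 ∈ nhds ((0 : ℂ) ^ n) := by
      simpa [hn] using Metric.ball_mem_nhds (0 : ℂ) one_pos
    filter_upwards [hpow.continuousAt hball] with z hz
    rw [exp_logDet hf (mem_ball_zero_iff.1 hz)]
    simp

end DetOneSub

section LogDecomposition

open PowerSeries

theorem hasSum_pnat_prod {ι M : Type*} [Fintype ι] [AddCommMonoid M] [TopologicalSpace M]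
    {F : ℕ → ι → M} {N : ℕ} (hF : ∀ n, N < n → ∀ i, F n i = 0) :
    HasSum (fun i : ℕ+ × ι => F i.1 i.2) (∑ n ∈ Finset.Icc 1 N, ∑ i, F n i) := by
  classical
  let s : Finset ℕ+ := (Finset.Icc 1 N).preimage (↑) PNat.coe_injective.injOn
  have hs : ∑ n ∈ Finset.Icc 1 N, ∑ i, F n i = ∑ i ∈ s ×ˢ Finset.univ, F i.1 i.2 := by
    rw [Finset.sum_product]
    refine (Finset.sum_preimage _ _ _ (fun n => ∑ i, F n i) fun n hn hn' => ?_).symm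
    exact absurd ⟨⟨n, (Finset.mem_Icc.1 hn).1⟩, rfl⟩ hn'
  rw [hs]
  refine hasSum_sum_of_ne_finset_zero fun i hi => hF _ (not_le.1 fun hle => hi ?_) _
  simp [s, hle, Nat.one_le_iff_ne_zero]

variable {G : Type*} [Group G]

/-- The formal power series `log det (I - χ(g) z ^ n)`. -/
def logDetSeries (n : ℕ) (χ : IrrChar G) (g : G) : ℂ⟦X⟧ :=
  logOf (((detOneSub (χ.rep g)).comp (Polynomial.X ^ n) : Polynomial ℂ) : ℂ⟦X⟧)

theorem logDetSeries_conj (n : ℕ) (χ : IrrChar G) (g h : G) :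
    logDetSeries n χ (h * g * h⁻¹) = logDetSeries n χ g := by
  rw [logDetSeries, detOneSub_apply_conj, logDetSeries]

theorem X_pow_dvd_logDetSeries {n : ℕ} (hn : n ≠ 0) (χ : IrrChar G) (g : G) :
    X ^ n ∣ logDetSeries n χ g :=
  (X_pow_dvd_logOf_iff (constantCoeff_comp_X_pow (eval_zero_detOneSub _) hn)).2
    (X_pow_dvd_comp_X_pow_sub_one (eval_zero_detOneSub _) n)

theorem coeff_logDetSeries_self {n : ℕ} (hn : n ≠ 0) (χ : IrrChar G) (g : G) :
    coeff n (logDetSeries n χ g) = -χ.1 g := by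
  rw [logDetSeries, coeff_logOf_comp_X_pow_self (eval_zero_detOneSub _) hn, coeff_one_detOneSub,
    ← χ.rep_character, Representation.character]

theorem coeff_logDetSeries_of_lt {n k : ℕ} (hk : k < n) (χ : IrrChar G) (g : G) :
    coeff k (logDetSeries n χ g) = 0 :=
  X_pow_dvd_iff.1 (X_pow_dvd_logDetSeries (by lia) χ g) k hk

theorem hasSum_smul_logDetSeries_iff [Finite G] (b : ℕ → IrrChar G → ℂ) (g : G) (f : ℂ⟦X⟧) :
    HasSum (fun i : ℕ+ × IrrChar G => -(b i.1 i.2 • logDetSeries i.1 i.2 g)) f ↔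
      ∀ k, coeff k f = -∑ n ∈ Finset.Icc 1 k, ∑ χ, b n χ * coeff k (logDetSeries n χ g) := by
  rw [WithPiTopology.hasSum_iff_hasSum_coeff]
  refine forall_congr' fun k => ?_
  have hsum := hasSum_pnat_prod (F := fun n χ => coeff k (-(b n χ • logDetSeries n χ g)))
    (N := k) fun n hn χ => by simp [coeff_logDetSeries_of_lt hn]
  simp only [← Finset.sum_neg_distrib, ← smul_eq_mul, ← coeff_smul, ← map_neg]
  exact ⟨fun h => h.unique hsum, fun h => h ▸ hsum⟩

variable [Fintype G]

/-- The recursively defined coefficients `b n χ` which make the power series `q g`, for `q` a class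
function, equal to `-∑ n χ, b n χ * log det (I - χ(g) z ^ n)`: since the `n`-th logarithms only
contribute from degree `n` on, where they contribute `-χ g`, one expands the degree `k` part of what
the `n < k` leave over in irreducible characters. -/
def logCoeff (q : G → ℂ⟦X⟧) (k : ℕ) : IrrChar G → ℂ :=
  charCoeff fun g => coeff k (q g) +
    ∑ n : Finset.Ico 1 k, ∑ χ, logCoeff q n χ * coeff k (logDetSeries n χ g)
termination_by k
decreasing_by exact (Finset.mem_Ico.1 n.2).2

theorem hasSum_logCoeff {q : G → ℂ⟦X⟧} (hq : ∀ g h, q (h * g * h⁻¹) = q g) {g : G}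
    (hg : constantCoeff (q g) = 0) :
    HasSum (fun i : ℕ+ × IrrChar G => -(logCoeff q i.1 i.2 • logDetSeries i.1 i.2 g)) (q g) := by
  refine (hasSum_smul_logDetSeries_iff _ g _).2 fun k => ?_
  rcases k.eq_zero_or_pos with rfl | hk
  · simpa using hg
  have hstep : ∑ χ, logCoeff q k χ * χ.1 g = coeff k (q g) +
      ∑ n : Finset.Ico 1 k, ∑ χ, logCoeff q n χ * coeff k (logDetSeries n χ g) := by
    rw [logCoeff]
    exact sum_charCoeff_mul (fun g h => by simp only [hq, logDetSeries_conj]) g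
  rw [Finset.sum_coe_sort (Finset.Ico 1 k)
    fun n => ∑ χ, logCoeff q n χ * coeff k (logDetSeries n χ g)] at hstep
  rw [← Finset.Ico_insert_right hk, Finset.sum_insert Finset.right_notMem_Ico]
  simp only [coeff_logDetSeries_self hk.ne', mul_neg, Finset.sum_neg_distrib, hstep]
  ring

variable (E : Type*) [Field E] [NumberField E]

theorem IsFrobenian.exists_eventually {A : Type*} {f : Nat.Primes → A} (hf : IsFrobenian E f) :
    ∃ c : Gal(E/ℚ) → A, (∀ g h, c (h * g * h⁻¹) = c g) ∧ ∀ᶠ p : Nat.Primes in Filter.cofinite,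
      Algebra.IsUnramifiedIn (𝓞 E) (Ideal.span {((p : ℕ) : ℤ)}) ∧
        ∀ σ, IsFrobeniusOver E p σ → f p = c σ :=
  let ⟨_, c, hT, hc, hTc⟩ := hf
  ⟨c, hc, Filter.mem_of_superset hT.compl_mem_cofinite hTc⟩

theorem exists_isLogDecomposition {Q : Nat.Primes → ℂ → ℂ}
    (hfrob : IsFrobenian E Q) (hQ0 : ∀ p, Q p 0 = 1) :
    ∃ b : ℕ → IrrChar Gal(E/ℚ) → ℂ, IsLogDecomposition E Q b := by
  classical
  obtain ⟨c, hc, hQc⟩ := hfrob.exists_eventually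
  refine ⟨logCoeff fun g => logOf (taylorSeries (c g)), hQc.mono fun p hp σ hσ => ?_⟩
  rw [hp.2 σ hσ]
  refine hasSum_logCoeff (q := fun g => logOf (taylorSeries (c g))) (fun g h => by rw [hc])
    (constantCoeff_logOf ?_)
  rw [constantCoeff_taylorSeries, ← hp.2 σ hσ, hQ0]

end LogDecomposition

section PrimePowers

open Filter Topology

theorem norm_prime_cpow_neg (p : Nat.Primes) (s : ℂ) : ‖(p : ℂ) ^ (-s)‖ = (p : ℝ) ^ (-s.re) := by
  rw [Complex.norm_natCast_cpow_of_pos p.2.pos, Complex.neg_re]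

theorem one_lt_prime (p : Nat.Primes) : (1 : ℝ) < (p : ℕ) := by exact_mod_cast p.2.one_lt

theorem prime_rpow_neg_lt_one (p : Nat.Primes) {x : ℝ} (hx : 0 < x) : (p : ℝ) ^ (-x) < 1 :=
  Real.rpow_lt_one_of_one_lt_of_neg (one_lt_prime p) (neg_lt_zero.2 hx)

theorem prime_rpow_neg_le_half (p : Nat.Primes) {x : ℝ} (hx : 1 ≤ x) :
    (p : ℝ) ^ (-x) ≤ 1 / 2 := by
  have hp : (2 : ℝ) ≤ (p : ℕ) := by exact_mod_cast p.2.two_le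
  calc (p : ℝ) ^ (-x) ≤ (p : ℝ) ^ (-1 : ℝ) :=
        Real.rpow_le_rpow_of_exponent_le (one_lt_prime p).le (neg_le_neg hx)
    _ ≤ 1 / 2 := by
        rw [Real.rpow_neg_one, ← one_div]
        gcongr

theorem summable_prime_rpow_neg {x : ℝ} (hx : 1 < x) :
    Summable fun p : Nat.Primes => (p : ℝ) ^ (-x) :=
  Nat.Primes.summable_rpow.2 (neg_lt_neg hx)

theorem tendsto_prime_rpow_neg_cofinite {x : ℝ} (hx : 0 < x) :
    Tendsto (fun p : Nat.Primes => (p : ℝ) ^ (-x)) cofinite (𝓝 0) :=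
  (tendsto_rpow_neg_atTop hx).comp (tendsto_natCast_atTop_atTop.comp
    (Nat.cofinite_eq_atTop ▸ Nat.Primes.coe_nat_injective.tendsto_cofinite))

end PrimePowers

section ArtinLog

open Filter Topology

variable {E : Type*} [Field E] [NumberField E] [IsGalois ℚ E]

theorem eq_one_of_mem_inertia {p : Nat.Primes} {𝔓 : Ideal (𝓞 E)}
    (hp : Algebra.IsUnramifiedIn (𝓞 E) (Ideal.span {((p : ℕ) : ℤ)})) (h𝔓 : IsPrimeAbove E p 𝔓)
    {σ : Gal(E/ℚ)} (hσ : IsArithFrobAt ℤ σ 𝔓) {g : Gal(E/ℚ)} (hg : g ∈ 𝔓.inertia Gal(E/ℚ)) :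
    g = 1 := by
  have := h𝔓.1
  have : Algebra.IsUnramifiedAt ℤ 𝔓 := hp 𝔓 h𝔓.1 h𝔓.2
  have hgσ : IsArithFrobAt ℤ (g * σ) 𝔓 := fun x => by
    simpa [mul_smul] using add_mem (hg (σ • x)) (hσ x)
  have heq := hgσ.eq_of_isUnramifiedAt hσ (Ideal.primeCompl_le_nonZeroDivisors 𝔓)
  have := (inferInstance : IsGaloisGroup Gal(E/ℚ) ℤ (𝓞 E)).faithful
  exact mul_eq_right.1 (FaithfulSMul.eq_of_smul_eq_smul (α := 𝓞 E) (DFunLike.congr_fun heq))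

variable {V : Type*} [AddCommGroup V] [Module ℂ V] (ρ : Representation ℂ Gal(E/ℚ) V)

/-- The endomorphism `ρ(Fr_p | V^{I_p})`; `artinPoly ρ p` is its `detOneSub`. -/
def frobInvariants (p : Nat.Primes) : inertiaInvariants ρ p →ₗ[ℂ] inertiaInvariants ρ p :=
  (ρ (frobAbove E p)).restrict (frob_mapsTo ρ p)

theorem exists_conj_frobInvariants {p : Nat.Primes}
    (hp : Algebra.IsUnramifiedIn (𝓞 E) (Ideal.span {((p : ℕ) : ℤ)})) :
    ∃ e : inertiaInvariants ρ p ≃ₗ[ℂ] V, e.conj (frobInvariants ρ p) = ρ (frobAbove E p) := by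
  have htop : inertiaInvariants ρ p = ⊤ := by
    refine eq_top_iff.2 fun v _ g hg => ?_
    rw [eq_one_of_mem_inertia hp (primeAbove_spec E p) (frobAbove_spec E p) hg]
    simp
  exact ⟨.ofTop _ htop, rfl⟩

variable [FiniteDimensional ℂ V]

theorem norm_le_one_of_mem_roots_charpoly_apply {G : Type*} [Group G] [Finite G]
    (ρ : Representation ℂ G V) (g : G) : ∀ μ ∈ (ρ g).charpoly.roots, ‖μ‖ ≤ 1 := fun _ hμ =>
  (norm_eq_one_of_mem_roots_charpoly Nat.card_pos.ne'
    (by rw [← map_pow, pow_card_eq_one', map_one]) hμ).le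

theorem norm_le_one_of_mem_roots_charpoly_frobInvariants (p : Nat.Primes) :
    ∀ μ ∈ (frobInvariants ρ p).charpoly.roots, ‖μ‖ ≤ 1 := fun _ hμ =>
  (norm_eq_one_of_mem_roots_charpoly (m := Nat.card Gal(E/ℚ)) Nat.card_pos.ne' (by
    have hpow : ρ (frobAbove E p) ^ Nat.card Gal(E/ℚ) = 1 := by
      rw [← map_pow, pow_card_eq_one', map_one]
    rw [frobInvariants, Module.End.pow_restrict]
    simp only [hpow]
    rfl) hμ).le

theorem norm_logDet_frobInvariants_le (p : Nat.Primes) {s : ℂ} {x : ℝ} (hx : 1 ≤ x)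
    (hs : x ≤ s.re) : ‖logDet (frobInvariants ρ p) ((p : ℂ) ^ (-s))‖ ≤
      Module.finrank ℂ V * (3 / 2 * (p : ℝ) ^ (-x)) := by
  have hhalf : ‖(p : ℂ) ^ (-s)‖ ≤ 1 / 2 := by
    rw [norm_prime_cpow_neg]
    exact prime_rpow_neg_le_half p (hx.trans hs)
  refine (norm_logDet_le (norm_le_one_of_mem_roots_charpoly_frobInvariants ρ p) hhalf).trans ?_
  rw [norm_prime_cpow_neg]
  gcongr
  · exact Submodule.finrank_le _
  · exact (one_lt_prime p).le

theorem summable_logDet_frobInvariants {s : ℂ} (hs : 1 < s.re) :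
    Summable fun p : Nat.Primes => logDet (frobInvariants ρ p) ((p : ℂ) ^ (-s)) :=
  .of_norm_bounded (((summable_prime_rpow_neg hs).mul_left _).mul_left _)
    fun p => norm_logDet_frobInvariants_le ρ p hs.le le_rfl

/-- The standard branch of `log L(s, ρ)` on `Re s > 1`, as a sum of local logarithms. -/
def logArtinL (s : ℂ) : ℂ := -∑' p : Nat.Primes, logDet (frobInvariants ρ p) ((p : ℂ) ^ (-s))

theorem hasProd_artinFactor {s : ℂ} (hs : 1 < s.re) :
    HasProd (fun p => artinFactor ρ p s) (Complex.exp (logArtinL ρ s)) := by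
  refine (summable_logDet_frobInvariants ρ hs).hasSum.neg.cexp.congr_fun fun p => ?_
  rw [Function.comp_apply, Complex.exp_neg,
    exp_logDet (norm_le_one_of_mem_roots_charpoly_frobInvariants ρ p), artinFactor]
  · rfl
  · rw [norm_prime_cpow_neg]
    exact prime_rpow_neg_lt_one p (by linarith)

theorem differentiableOn_logDet_frobInvariants (p : Nat.Primes) :
    DifferentiableOn ℂ (fun s : ℂ => logDet (frobInvariants ρ p) ((p : ℂ) ^ (-s)))
      {s | 0 < s.re} := by
  have hp : ((p : ℕ) : ℂ) ≠ 0 := by exact_mod_cast p.2.ne_zero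
  refine (differentiableOn_logDet (norm_le_one_of_mem_roots_charpoly_frobInvariants ρ p)).comp
    (f := fun s : ℂ => (p : ℂ) ^ (-s))
    (differentiable_neg.const_cpow (.inl hp)).differentiableOn fun s (hs : 0 < s.re) => ?_
  rw [mem_ball_zero_iff, norm_prime_cpow_neg]
  exact prime_rpow_neg_lt_one p hs

theorem differentiableOn_logArtinL : DifferentiableOn ℂ (logArtinL ρ) {s | 1 < s.re} := by
  refine DifferentiableOn.fun_neg fun s (hs : 1 < s.re) => ?_
  obtain ⟨x, hx, hxs⟩ := exists_between hs
  have hopen : IsOpen {w : ℂ | x < w.re} := isOpen_lt continuous_const Complex.continuous_re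
  refine ((Complex.differentiableOn_tsum_of_summable_norm
    (((summable_prime_rpow_neg hx).mul_left _).mul_left _) (fun p => ?_) hopen
      fun p w hw => norm_logDet_frobInvariants_le ρ p hx.le (le_of_lt hw)).differentiableAt
    (hopen.mem_nhds hxs)).differentiableWithinAt
  exact (differentiableOn_logDet_frobInvariants ρ p).mono
    fun w (hw : x < w.re) => show 0 < w.re by linarith

theorem tendsto_logArtinL : Tendsto (fun x : ℝ => logArtinL ρ x) atTop (𝓝 0) := by
  have hsum : Tendsto
      (fun x : ℝ => ∑' p : Nat.Primes, logDet (frobInvariants ρ p) ((p : ℂ) ^ (-(x : ℂ))))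
      atTop (𝓝 (∑' _ : Nat.Primes, 0)) := by
    refine tendsto_tsum_of_dominated_convergence
      (((summable_prime_rpow_neg one_lt_two).mul_left _).mul_left _) (fun p => ?_)
      ((eventually_ge_atTop 2).mono fun x hx p =>
        norm_logDet_frobInvariants_le ρ p one_le_two (by simpa using hx))
    have hpow : Tendsto (fun x : ℝ => (p : ℝ) ^ (-x)) atTop (𝓝 0) :=
      (tendsto_rpow_atBot_of_base_gt_one _ (one_lt_prime p)).comp tendsto_neg_atTop_atBot
    refine squeeze_zero_norm' ((eventually_ge_atTop 1).mono fun x hx =>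
      norm_logDet_frobInvariants_le ρ p hx (by simp)) ?_
    simpa using (hpow.const_mul (3 / 2)).const_mul (Module.finrank ℂ V : ℝ)
  simpa [logArtinL] using hsum.neg

theorem isLogArtinL_logArtinL : IsLogArtinL ρ (logArtinL ρ) where
  differentiableOn := differentiableOn_logArtinL ρ
  multipliable _ hs := (hasProd_artinFactor ρ hs).multipliable
  exp_eq _ hs := (hasProd_artinFactor ρ hs).tprod_eq.symm
  tendsto := tendsto_logArtinL ρ

end ArtinLog

section EulerProduct

section Multiplicative

variable {f : ℕ → ℝ} (hf : ∀ n, 0 ≤ f n) (hf1 : f 1 = 1)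
  (hmul : ∀ {m n : ℕ}, m.Coprime n → f (m * n) = f m * f n)
  (hloc : ∀ p : Nat.Primes, Summable fun k => f (p ^ k))
  (hsum : Summable fun p : Nat.Primes => ∑' k, f (p ^ (k + 1)))

include hf hf1 hloc hsum in
theorem prod_primesBelow_tsum_pow_le_exp (N : ℕ) :
    ∏ p ∈ N.primesBelow, ∑' k, f (p ^ k) ≤
      Real.exp (∑' p : Nat.Primes, ∑' k, f (p ^ (k + 1))) := by
  have hnonneg (p : Nat.Primes) : 0 ≤ ∑' k, f (p ^ (k + 1)) := tsum_nonneg fun _ => hf _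
  let s : Finset Nat.Primes := (Finset.range N).subtype Nat.Prime
  calc ∏ p ∈ N.primesBelow, ∑' k, f (p ^ k)
      = ∏ p ∈ s, ∑' k, f (p ^ k) :=
        (Finset.prod_subtype_eq_prod_filter fun p => ∑' k, f (p ^ k)).symm
    _ = ∏ p ∈ s, (1 + ∑' k, f (p ^ (k + 1))) := by
        refine Finset.prod_congr rfl fun p _ => ?_
        rw [(hloc p).tsum_eq_zero_add, pow_zero, hf1]
    _ ≤ Real.exp (∑ p ∈ s, ∑' k, f (p ^ (k + 1))) :=
        Real.prod_one_add_le_exp_sum _ hnonneg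
    _ ≤ Real.exp (∑' p : Nat.Primes, ∑' k, f (p ^ (k + 1))) :=
        Real.exp_le_exp.2 (hsum.sum_le_tsum _ fun p _ => hnonneg p)

include hf hf1 hmul hloc hsum in
theorem summable_of_multiplicative_of_nonneg (hf0 : f 0 = 0) : Summable f := by
  refine summable_of_sum_le (c := Real.exp (∑' p : Nat.Primes, ∑' k, f (p ^ (k + 1)))) hf
    fun t => ?_
  obtain ⟨N, hN⟩ := t.exists_nat_subset_range
  have hsmooth : HasSum (N.smoothNumbers.indicator f) (∏ p ∈ N.primesBelow, ∑' k, f (p ^ k)) :=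
    hasSum_subtype_iff_indicator.1
      (EulerProduct.summable_and_hasSum_smoothNumbers_prod_primesBelow_tsum hf1 hmul
        (fun hp => (hloc ⟨_, hp⟩).norm) N).2
  calc ∑ m ∈ t, f m = ∑ m ∈ t, N.smoothNumbers.indicator f m := by
        refine Finset.sum_congr rfl fun m hm => ?_
        rcases m.eq_zero_or_pos with rfl | hpos
        · simp [Set.indicator_apply, hf0]
        · rw [Set.indicator_of_mem
            (Nat.mem_smoothNumbers_of_lt hpos (Finset.mem_range.1 (hN hm)))]
    _ ≤ ∏ p ∈ N.primesBelow, ∑' k, f (p ^ k) :=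
        sum_le_hasSum t (fun m _ => Set.indicator_nonneg (fun _ _ => hf _) m) hsmooth
    _ ≤ _ := prod_primesBelow_tsum_pow_le_exp hf hf1 hloc hsum N

end Multiplicative

/-- The coefficients of the Dirichlet series with Euler product
`∏ p, ∑ k, φ p k * p ^ (-k * s)`, where `φ p 0 = 1`. -/
def eulerCoeff (φ : Nat.Primes → ℕ → ℂ) (m : ℕ) : ℂ :=
  ∏ᶠ p : Nat.Primes, φ p (m.factorization p)

variable {φ : Nat.Primes → ℕ → ℂ} (hφ : ∀ p, φ p 0 = 1)

include hφ

theorem eulerCoeff_one : eulerCoeff φ 1 = 1 := by simp [eulerCoeff, hφ]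

theorem hasFiniteMulSupport_factorization (m : ℕ) :
    Function.HasFiniteMulSupport fun p : Nat.Primes => φ p (m.factorization p) := by
  refine (m.primeFactors.finite_toSet.preimage Nat.Primes.coe_nat_injective.injOn).subset
    fun (p : Nat.Primes) (hp : φ p (m.factorization p) ≠ 1) => ?_
  have h0 : m.factorization p ≠ 0 := fun h => hp (by rw [h, hφ])
  exact Finsupp.mem_support_iff.2 h0

theorem eulerCoeff_mul {m n : ℕ} (h : m.Coprime n) :
    eulerCoeff φ (m * n) = eulerCoeff φ m * eulerCoeff φ n := by
  rw [eulerCoeff, eulerCoeff, eulerCoeff, ← finprod_mul_distrib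
    (hasFiniteMulSupport_factorization hφ m) (hasFiniteMulSupport_factorization hφ n)]
  refine finprod_congr fun p => ?_
  rw [Nat.factorization_mul_of_coprime h, Finsupp.add_apply]
  by_cases hp : (p : ℕ) ∣ m
  · have hn : ¬(p : ℕ) ∣ n := fun hn => Nat.not_coprime_of_dvd_of_dvd p.2.one_lt hp hn h
    rw [Nat.factorization_eq_zero_of_not_dvd hn, add_zero, hφ, mul_one]
  · rw [Nat.factorization_eq_zero_of_not_dvd hp, zero_add, hφ, one_mul]

theorem eulerCoeff_prime_pow (p : Nat.Primes) (k : ℕ) : eulerCoeff φ (p ^ k) = φ p k := by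
  rw [eulerCoeff, finprod_eq_single _ p]
  · rw [p.2.factorization_pow, Finsupp.single_eq_same]
  · intro q hq
    rw [p.2.factorization_pow,
      Finsupp.single_eq_of_ne (Nat.Primes.coe_nat_injective.ne hq), hφ]

theorem term_eulerCoeff_one (s : ℂ) : LSeries.term (eulerCoeff φ) s 1 = 1 := by
  simp [LSeries.term_of_ne_zero, eulerCoeff_one hφ]

theorem term_eulerCoeff_mul (s : ℂ) {m n : ℕ} (h : m.Coprime n) :
    LSeries.term (eulerCoeff φ) s (m * n) =
      LSeries.term (eulerCoeff φ) s m * LSeries.term (eulerCoeff φ) s n := by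
  rcases eq_or_ne m 0 with rfl | hm
  · simp
  rcases eq_or_ne n 0 with rfl | hn
  · simp
  rw [LSeries.term_of_ne_zero (mul_ne_zero hm hn), LSeries.term_of_ne_zero hm,
    LSeries.term_of_ne_zero hn, eulerCoeff_mul hφ h, Nat.cast_mul,
    Complex.natCast_mul_natCast_cpow, div_mul_div_comm]

theorem term_eulerCoeff_prime_pow (s : ℂ) (p : Nat.Primes) (k : ℕ) :
    LSeries.term (eulerCoeff φ) s (p ^ k) = φ p k * ((p : ℂ) ^ (-s)) ^ k := by
  rw [LSeries.term_of_ne_zero (pow_ne_zero k p.2.ne_zero), eulerCoeff_prime_pow hφ,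
    Complex.cpow_neg, inv_pow, Nat.cast_pow, ← Complex.natCast_cpow_natCast_mul,
    div_eq_mul_inv, Complex.cpow_nat_mul]

theorem norm_term_eulerCoeff_prime_pow (s : ℂ) (p : Nat.Primes) (k : ℕ) :
    ‖LSeries.term (eulerCoeff φ) s (p ^ k)‖ = ‖φ p k‖ * ((p : ℝ) ^ (-s.re)) ^ k := by
  rw [term_eulerCoeff_prime_pow hφ, norm_mul, norm_pow, norm_prime_cpow_neg]

variable {s : ℂ} (hloc : ∀ p : Nat.Primes, Summable fun k => ‖φ p k‖ * ((p : ℝ) ^ (-s.re)) ^ k)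
  (hsum : Summable fun p : Nat.Primes => ∑' k, ‖φ p (k + 1)‖ * ((p : ℝ) ^ (-s.re)) ^ (k + 1))

include hloc hsum

theorem lseriesSummable_eulerCoeff : LSeriesSummable (eulerCoeff φ) s := by
  refine Summable.of_norm (summable_of_multiplicative_of_nonneg (fun _ => norm_nonneg _) ?_
    (fun h => ?_) (fun p => ?_) ?_ ?_)
  · rw [term_eulerCoeff_one hφ, norm_one]
  · rw [term_eulerCoeff_mul hφ s h, norm_mul]
  · simpa only [norm_term_eulerCoeff_prime_pow hφ] using hloc p
  · simpa only [norm_term_eulerCoeff_prime_pow hφ] using hsum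
  · rw [LSeries.term_zero, norm_zero]

theorem hasProd_lseries_eulerCoeff :
    HasProd (fun p : Nat.Primes => ∑' k, φ p k * ((p : ℂ) ^ (-s)) ^ k)
      (LSeries (eulerCoeff φ) s) := by
  refine (EulerProduct.eulerProduct_hasProd (term_eulerCoeff_one hφ s) (term_eulerCoeff_mul hφ s)
    (lseriesSummable_eulerCoeff hφ hloc hsum).norm (LSeries.term_zero _ s)).congr_fun fun p => ?_
  simp only [term_eulerCoeff_prime_pow hφ]

end EulerProduct

section TaylorTail

open Asymptotics Filter Metric PowerSeries Topology

variable {F : ℂ → ℂ} {R : ℝ}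

theorem hasSum_coeff_taylorSeries (hF : DifferentiableOn ℂ F (ball 0 R)) {z : ℂ} (hz : ‖z‖ < R) :
    HasSum (fun k => coeff k (taylorSeries F) * z ^ k) (F z) := by
  refine (Complex.hasSum_taylorSeries_on_ball hF (mem_ball_zero_iff.2 hz)).congr_fun fun k => ?_
  rw [coeff_taylorSeries, sub_zero, smul_eq_mul, smul_eq_mul]
  ring

theorem summable_norm_coeff_taylorSeries (hF : DifferentiableOn ℂ F (ball 0 R)) {x : ℝ}
    (hx0 : 0 ≤ x) (hx : x < R) : Summable fun k => ‖coeff k (taylorSeries F)‖ * x ^ k := by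
  have hnorm : ‖(x : ℂ)‖ = x := Complex.norm_of_nonneg hx0
  simpa only [norm_mul, norm_pow, hnorm] using
    (hasSum_coeff_taylorSeries hF (hnorm.trans_lt hx)).summable.norm

/-- The tail `∑ k ≥ 1, ‖c k‖ * x ^ k` of the majorant of the Taylor series `∑ k, c k * z ^ k` of
`F` at `0`. -/
def taylorTail (F : ℂ → ℂ) (x : ℝ) : ℝ :=
  ∑' k, ‖coeff (k + 1) (taylorSeries F)‖ * x ^ (k + 1)

theorem taylorTail_nonneg (F : ℂ → ℂ) {x : ℝ} (hx : 0 ≤ x) : 0 ≤ taylorTail F x :=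
  tsum_nonneg fun _ => by positivity

theorem norm_sub_le_taylorTail (hF : DifferentiableOn ℂ F (ball 0 R)) {z : ℂ} (hz : ‖z‖ < R) :
    ‖F z - F 0‖ ≤ taylorTail F ‖z‖ := by
  have hsum := hasSum_coeff_taylorSeries hF hz
  have htail : F z - F 0 = ∑' k, coeff (k + 1) (taylorSeries F) * z ^ (k + 1) := by
    rw [← hsum.tsum_eq, hsum.summable.tsum_eq_zero_add, pow_zero, mul_one,
      coeff_zero_eq_constantCoeff_apply, constantCoeff_taylorSeries, add_sub_cancel_left]
  have hnorm := (summable_nat_add_iff 1).2 hsum.summable.norm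
  rw [htail]
  refine (norm_tsum_le_tsum_norm hnorm).trans_eq ?_
  simp only [norm_mul, norm_pow, taylorTail]

theorem taylorTail_le (hF : DifferentiableOn ℂ F (ball 0 R)) {N : ℕ}
    (hdvd : X ^ (N + 1) ∣ taylorSeries F - 1) {x y : ℝ} (hx : 0 ≤ x) (hxy : x ≤ y) (hy : 0 < y)
    (hyR : y < R) : taylorTail F x ≤ taylorTail F y * (x / y) ^ (N + 1) := by
  have hsum {t : ℝ} (ht : 0 ≤ t) (hty : t ≤ y) :=
    (summable_nat_add_iff 1).2 (summable_norm_coeff_taylorSeries hF ht (hty.trans_lt hyR))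
  rw [taylorTail, taylorTail, ← tsum_mul_right]
  refine (hsum hx hxy).tsum_le_tsum (fun k => ?_) ((hsum hy.le le_rfl).mul_right _)
  rcases lt_or_ge k N with hk | hk
  · have hcoeff : coeff (k + 1) (taylorSeries F) = 0 := by
      simpa [coeff_one] using X_pow_dvd_iff.1 hdvd (k + 1) (by lia)
    simp [hcoeff]
  · have hpow : (x / y) ^ (k + 1) ≤ (x / y) ^ (N + 1) :=
      pow_le_pow_of_le_one (by positivity) (div_le_one_of_le₀ hxy hy.le) (by lia)
    calc ‖coeff (k + 1) (taylorSeries F)‖ * x ^ (k + 1)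
        = ‖coeff (k + 1) (taylorSeries F)‖ * y ^ (k + 1) * (x / y) ^ (k + 1) := by
          rw [mul_assoc, ← mul_pow, mul_div_cancel₀ _ hy.ne']
      _ ≤ _ := by gcongr

theorem taylorTail_isBigO (hR : 0 < R) (hF : DifferentiableOn ℂ F (ball 0 R)) {N : ℕ}
    (hdvd : X ^ (N + 1) ∣ taylorSeries F - 1) :
    taylorTail F =O[𝓝[≥] 0] fun x => x ^ (N + 1) := by
  obtain ⟨y, hy, hyR⟩ := exists_between hR
  refine .of_bound (taylorTail F y / y ^ (N + 1)) ?_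
  filter_upwards [Icc_mem_nhdsGE hy] with x ⟨hx, hxy⟩
  rw [Real.norm_of_nonneg (taylorTail_nonneg F hx), Real.norm_of_nonneg (by positivity)]
  refine (taylorTail_le hF hdvd hx hxy hy hyR).trans_eq ?_
  rw [div_pow]
  ring

theorem summable_taylorTail (hR : 0 < R) (hF : DifferentiableOn ℂ F (ball 0 R)) {N : ℕ}
    (hdvd : X ^ (N + 1) ∣ taylorSeries F - 1) {x : ℝ} (hx : 1 < x * (N + 1)) :
    Summable fun p : Nat.Primes => taylorTail F ((p : ℝ) ^ (-x)) := by
  have hx0 : 0 < x := pos_of_mul_pos_left (one_pos.trans hx) (by positivity)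
  have hpow (p : Nat.Primes) : ((p : ℝ) ^ (-x)) ^ (N + 1) = (p : ℝ) ^ (-(x * (N + 1))) := by
    rw [← Real.rpow_mul_natCast (Nat.cast_nonneg _), neg_mul, Nat.cast_succ]
  have htendsto : Tendsto (fun p : Nat.Primes => (p : ℝ) ^ (-x)) cofinite (𝓝[≥] 0) :=
    tendsto_nhdsWithin_iff.2 ⟨tendsto_prime_rpow_neg_cofinite hx0,
      .of_forall fun _ => Real.rpow_nonneg (Nat.cast_nonneg _) _⟩
  refine summable_of_isBigO (summable_prime_rpow_neg hx) ?_
  simpa only [Function.comp_def, hpow] using (taylorTail_isBigO hR hF hdvd).comp_tendsto htendsto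

theorem summable_taylorTail_of_eventually_mem {𝓕 : Set (ℂ → ℂ)} (h𝓕 : 𝓕.Finite)
    {F : Nat.Primes → ℂ → ℂ} (hmem : ∀ᶠ p in cofinite, F p ∈ 𝓕) (hR : 0 < R) {N : ℕ}
    (hF : ∀ᶠ p in cofinite,
      DifferentiableOn ℂ (F p) (ball 0 R) ∧ X ^ (N + 1) ∣ taylorSeries (F p) - 1)
    {x : ℝ} (hx : 1 < x * (N + 1)) :
    Summable fun p : Nat.Primes => taylorTail (F p) ((p : ℝ) ^ (-x)) := by
  classical
  have hfin := h𝓕.inter_of_left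
    {f | DifferentiableOn ℂ f (ball 0 R) ∧ X ^ (N + 1) ∣ taylorSeries f - 1}
  have hsum : Summable fun p : Nat.Primes => ∑ f ∈ hfin.toFinset, taylorTail f ((p : ℝ) ^ (-x)) :=
    summable_sum fun f hf => by
      obtain ⟨-, hdiff, hdvd⟩ := hfin.mem_toFinset.1 hf
      exact summable_taylorTail hR hdiff hdvd hx
  refine hsum.of_norm_bounded_eventually ?_
  filter_upwards [hmem, hF] with p hp hFp
  have hnonneg (f : ℂ → ℂ) : 0 ≤ taylorTail f ((p : ℝ) ^ (-x)) :=
    taylorTail_nonneg f (Real.rpow_nonneg (Nat.cast_nonneg _) _)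
  rw [Real.norm_of_nonneg (hnonneg _)]
  exact Finset.single_le_sum (f := fun f => taylorTail f ((p : ℝ) ^ (-x)))
    (fun f _ => hnonneg f) (hfin.mem_toFinset.2 ⟨hp, hFp⟩)

variable {F : Nat.Primes → ℂ → ℂ} (hF0 : ∀ p, F p 0 = 1) {R : Nat.Primes → ℝ}
  (hF : ∀ p, DifferentiableOn ℂ (F p) (ball 0 (R p))) {s : ℂ}
  (hs : ∀ p : Nat.Primes, (p : ℝ) ^ (-s.re) < R p)
  (htail : Summable fun p : Nat.Primes => taylorTail (F p) ((p : ℝ) ^ (-s.re)))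

include hF0 in
theorem coeff_zero_taylorSeries_eq_one (p : Nat.Primes) : coeff 0 (taylorSeries (F p)) = 1 := by
  rw [coeff_zero_eq_constantCoeff_apply, constantCoeff_taylorSeries, hF0]

include hF0 hF hs htail

theorem lseriesSummable_eulerCoeff_taylorSeries :
    LSeriesSummable (eulerCoeff fun p k => coeff k (taylorSeries (F p))) s :=
  lseriesSummable_eulerCoeff (coeff_zero_taylorSeries_eq_one hF0)
    (fun p => summable_norm_coeff_taylorSeries (hF p) (by positivity) (hs p)) htail

theorem hasProd_eulerCoeff_taylorSeries :
    HasProd (fun p : Nat.Primes => F p ((p : ℂ) ^ (-s)))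
      (LSeries (eulerCoeff fun p k => coeff k (taylorSeries (F p))) s) := by
  refine (hasProd_lseries_eulerCoeff (coeff_zero_taylorSeries_eq_one hF0)
    (fun p => summable_norm_coeff_taylorSeries (hF p) (by positivity) (hs p)) htail).congr_fun
      fun p => ?_
  exact (hasSum_coeff_taylorSeries (hF p) ((norm_prime_cpow_neg p s).trans_lt (hs p))).tsum_eq.symm

end TaylorTail

section LocalFactor

open Metric PowerSeries Topology

theorem X_pow_dvd_taylorSeries_mul_exp_sub_one_iff {q L : ℂ → ℂ} (hq : AnalyticAt ℂ q 0)
    (hq0 : q 0 = 1) (hL : AnalyticAt ℂ L 0) (hL0 : L 0 = 0) (n : ℕ) :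
    X ^ n ∣ taylorSeries (fun z => q z * Complex.exp (L z)) - 1 ↔
      X ^ n ∣ logOf (taylorSeries q) + taylorSeries L := by
  have hslit : q 0 ∈ Complex.slitPlane := hq0 ▸ Complex.one_mem_slitPlane
  have hlog : AnalyticAt ℂ (fun z => Complex.log (q z)) 0 := hq.clog hslit
  have hexp : (fun z => Complex.exp (Complex.log (q z))) =ᶠ[𝓝 0] q :=
    (hq.continuousAt.eventually_ne (Complex.slitPlane_ne_zero hslit)).mono
      fun z hz => Complex.exp_log hz
  rw [← X_pow_dvd_logOf_iff (by simp [constantCoeff_taylorSeries, hq0, hL0]),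
    logOf_taylorSeries hlog (by simp [hq0]) hexp, ← taylorSeries_add hlog hL,
    logOf_taylorSeries (hlog.fun_add hL) (by simp [hq0, hL0])]
  exact hexp.mono fun z hz => (Complex.exp_add _ _).trans (congrArg (· * Complex.exp (L z)) hz)

variable {I : Type*} [Fintype I]

/-- The finite sum `∑ n ≤ N, ∑ i, b n i * L i (z ^ n)`, where `L i` is a logarithm of an inverse
Euler factor. -/
def localExponent (b : ℕ → I → ℂ) (N : ℕ) (L : I → ℂ → ℂ) (z : ℂ) : ℂ :=
  ∑ n ∈ Finset.Icc 1 N, ∑ i, b n i * L i (z ^ n)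

/-- The function `q(z) * ∏ n ≤ N, ∏ i, exp (L i (z ^ n)) ^ b n i`: an Euler factor `q` corrected
by powers of the Euler factors `exp (-L i)`. -/
def localFactor (q : ℂ → ℂ) (b : ℕ → I → ℂ) (N : ℕ) (L : I → ℂ → ℂ) (z : ℂ) : ℂ :=
  q z * Complex.exp (localExponent b N L z)

variable (b : ℕ → I → ℂ) (N : ℕ) {L : I → ℂ → ℂ}

theorem differentiableOn_localExponent (hL : ∀ i, DifferentiableOn ℂ (L i) (ball 0 1)) :
    DifferentiableOn ℂ (localExponent b N L) (ball 0 1) := by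
  refine .fun_sum fun n hn => .fun_sum fun i _ => .const_mul ?_ _
  refine (hL i).comp (f := fun z : ℂ => z ^ n) (by fun_prop) fun z hz => ?_
  rw [mem_ball_zero_iff] at hz ⊢
  rw [norm_pow]
  exact pow_lt_one₀ (norm_nonneg z) hz (Nat.one_le_iff_ne_zero.1 (Finset.mem_Icc.1 hn).1)

theorem localExponent_zero (hL0 : ∀ i, L i 0 = 0) : localExponent b N L 0 = 0 :=
  Finset.sum_eq_zero fun n hn => Finset.sum_eq_zero fun i _ => by
    rw [zero_pow (Nat.one_le_iff_ne_zero.1 (Finset.mem_Icc.1 hn).1), hL0, mul_zero]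

theorem taylorSeries_localExponent (hL : ∀ i, AnalyticAt ℂ (L i) 0) :
    taylorSeries (localExponent b N L) =
      ∑ n ∈ Finset.Icc 1 N, ∑ i, b n i • taylorSeries fun z => L i (z ^ n) := by
  have han (n : ℕ) (hn : n ∈ Finset.Icc 1 N) (i : I) :
      AnalyticAt ℂ (fun z => b n i * L i (z ^ n)) 0 :=
    analyticAt_const.fun_mul (.comp_of_eq (hL i) (by fun_prop)
      (zero_pow (Nat.one_le_iff_ne_zero.1 (Finset.mem_Icc.1 hn).1)))
  unfold localExponent
  rw [taylorSeries_sum _ fun n hn => Finset.analyticAt_fun_sum _ fun i _ => han n hn i]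
  refine Finset.sum_congr rfl fun n hn => ?_
  simp only [taylorSeries_sum _ fun i _ => han n hn i, taylorSeries_const_mul]

theorem localFactor_zero {q : ℂ → ℂ} (hq0 : q 0 = 1) (hL0 : ∀ i, L i 0 = 0) :
    localFactor q b N L 0 = 1 := by
  rw [localFactor, localExponent_zero b N hL0, hq0, Complex.exp_zero, mul_one]

theorem differentiableOn_localFactor {q : ℂ → ℂ} {R : ℝ} (hR : R ≤ 1)
    (hq : DifferentiableOn ℂ q (ball 0 R)) (hL : ∀ i, DifferentiableOn ℂ (L i) (ball 0 1)) :
    DifferentiableOn ℂ (localFactor q b N L) (ball 0 R) :=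
  hq.fun_mul ((differentiableOn_localExponent b N hL).mono (ball_subset_ball hR)).cexp

theorem X_pow_dvd_taylorSeries_localFactor_sub_one {G : Type*} [Group G] [Finite G]
    (b : ℕ → IrrChar G → ℂ) (N : ℕ) (g : G) {q : ℂ → ℂ} (hq : AnalyticAt ℂ q 0) (hq0 : q 0 = 1)
    (hlog : HasSum (fun i : ℕ+ × IrrChar G => -(b i.1 i.2 • logDetSeries i.1 i.2 g))
      (logOf (taylorSeries q))) :
    X ^ (N + 1) ∣ taylorSeries (localFactor q b N fun χ => logDet (χ.rep g)) - 1 := by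
  have hroots (χ : IrrChar G) := norm_le_one_of_mem_roots_charpoly_apply χ.rep g
  have hL (χ : IrrChar G) := differentiableOn_logDet (hroots χ)
  have htaylor : taylorSeries (localExponent b N fun χ => logDet (χ.rep g)) =
      ∑ n ∈ Finset.Icc 1 N, ∑ χ, b n χ • logDetSeries n χ g := by
    rw [taylorSeries_localExponent b N fun χ => (hL χ).analyticAt (ball_mem_nhds 0 one_pos)]
    refine Finset.sum_congr rfl fun n hn => Finset.sum_congr rfl fun χ _ => ?_
    rw [taylorSeries_logDet_pow (hroots χ) (Nat.one_le_iff_ne_zero.1 (Finset.mem_Icc.1 hn).1),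
      logDetSeries]
  refine (X_pow_dvd_taylorSeries_mul_exp_sub_one_iff hq hq0
    ((differentiableOn_localExponent b N hL).analyticAt (ball_mem_nhds 0 one_pos))
    (localExponent_zero b N fun _ => logDet_zero _) _).2 (X_pow_dvd_iff.2 fun k hk => ?_)
  rw [map_add, (hasSum_smul_logDetSeries_iff b g _).1 hlog, htaylor, neg_add_eq_zero]
  simp only [map_sum, coeff_smul, smul_eq_mul]
  refine Finset.sum_subset (Finset.Icc_subset_Icc_right (by lia)) fun n hn hnk => ?_
  have hlt : k < n := by
    simp only [Finset.mem_Icc, not_and, not_le] at hn hnk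
    exact hnk hn.1
  exact Finset.sum_eq_zero fun χ _ => by rw [coeff_logDetSeries_of_lt hlt, mul_zero]

end LocalFactor

section DirichletSeries

open Filter Metric PowerSeries Topology

theorem differentiableOn_lseries_of_summable {a : ℕ → ℂ} {x : ℝ}
    (ha : ∀ s : ℂ, x < s.re → LSeriesSummable a s) :
    DifferentiableOn ℂ (LSeries a) {s | x < s.re} := by
  have habs := LSeries.abscissaOfAbsConv_le_of_forall_lt_LSeriesSummable (f := a) (x := x)
    fun y hy => ha y (by simpa using hy)
  exact (LSeries_differentiableOn a).mono fun s hs => habs.trans_lt (EReal.coe_lt_coe_iff.2 hs)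

theorem multipliable_of_summable_norm_sub_one {ι : Type*} {f : ι → ℂ}
    (hf : Summable fun i => ‖f i - 1‖) : Multipliable f := by
  simpa using multipliable_one_add_of_summable hf

theorem tprod_mul_prod_inv_eq_tprod_compl {ι : Type*} {f : ι → ℂ} {D : Finset ι}
    (hf : Multipliable fun i : {i // i ∉ D} => f i) (hD : ∀ i ∈ D, f i ≠ 0) :
    (∏' i, f i) * ∏ i ∈ D, (f i)⁻¹ = ∏' i : {i // i ∉ D}, f i := by
  have hprod := (HasProd.mul_compl (s := (D : Set ι)) (D.hasProd f) hf.hasProd).tprod_eq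
  rw [hprod, Finset.prod_inv_distrib, mul_right_comm,
    mul_inv_cancel₀ (Finset.prod_ne_zero_iff.2 hD), one_mul]

theorem prime_rpow_neg_lt_of_notMem_primesLE {r ε x : ℝ} (hr : 0 < r) (hε : 0 < ε) (hx : ε ≤ x)
    {p : Nat.Primes} (hp : p ∉ primesLE (r ^ (-1 / ε))) : (p : ℝ) ^ (-x) < r := by
  rw [mem_primesLE, not_le] at hp
  calc (p : ℝ) ^ (-x) ≤ (p : ℝ) ^ (-ε) :=
        Real.rpow_le_rpow_of_exponent_le (one_lt_prime p).le (neg_le_neg hx)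
    _ < (r ^ (-1 / ε)) ^ (-ε) := Real.rpow_lt_rpow_of_neg (by positivity) hp (neg_lt_zero.2 hε)
    _ = r := by rw [← Real.rpow_mul hr.le, show -1 / ε * -ε = 1 by field_simp, Real.rpow_one]

variable {E : Type*} [Field E] [NumberField E] [IsGalois ℚ E]

theorem isFrobeniusOver_frobAbove (p : Nat.Primes) : IsFrobeniusOver E p (frobAbove E p) :=
  ⟨_, primeAbove_spec E p, frobAbove_spec E p⟩

theorem IsFrobenian.summable_norm_sub_one {Q : Nat.Primes → ℂ → ℂ} (hfrob : IsFrobenian E Q)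
    (hQ0 : ∀ p, Q p 0 = 1) {r : ℝ} (hr : 0 < r)
    (hdiff : ∀ p, DifferentiableOn ℂ (Q p) (ball 0 r)) {s : ℂ} (hs : 1 < s.re) :
    Summable fun p : Nat.Primes => ‖Q p ((p : ℂ) ^ (-s)) - 1‖ := by
  obtain ⟨c, -, hc⟩ := hfrob.exists_eventually
  refine Summable.of_norm_bounded_eventually (summable_taylorTail_of_eventually_mem
    (Set.finite_range c) (hc.mono fun p hp => ⟨_, (hp.2 _ (isFrobeniusOver_frobAbove p)).symm⟩) hr
    (N := 0) (.of_forall fun p => ⟨hdiff p, ?_⟩) (x := s.re) (by simpa using hs)) ?_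
  · rw [zero_add, pow_one, X_dvd_iff, map_sub, constantCoeff_taylorSeries, hQ0, map_one, sub_self]
  · filter_upwards [(tendsto_prime_rpow_neg_cofinite (one_pos.trans hs)).eventually_lt_const hr]
      with p hp
    rw [← norm_prime_cpow_neg] at hp ⊢
    rw [norm_norm, ← hQ0 p]
    exact norm_sub_le_taylorTail (hdiff p) hp

variable (b : ℕ → IrrChar Gal(E/ℚ) → ℂ) (N : ℕ)

theorem logDet_frobInvariants {V : Type*} [AddCommGroup V] [Module ℂ V] [FiniteDimensional ℂ V]
    (ρ : Representation ℂ Gal(E/ℚ) V) {p : Nat.Primes}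
    (hp : Algebra.IsUnramifiedIn (𝓞 E) (Ideal.span {((p : ℕ) : ℤ)})) :
    logDet (frobInvariants ρ p) = logDet (ρ (frobAbove E p)) := by
  obtain ⟨e, he⟩ := exists_conj_frobInvariants ρ hp
  rw [← he, logDet_conj]

theorem hasProd_exp_localExponent {s : ℂ} (hs : 1 < s.re) :
    HasProd (fun p : Nat.Primes => Complex.exp
        (localExponent b N (fun χ => logDet (frobInvariants χ.rep p)) ((p : ℂ) ^ (-s))))
      (∏ n ∈ Finset.Icc 1 N, ∏ χ, Complex.exp (-b n χ * logArtinL χ.rep (n * s))) := by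
  simp only [← Complex.exp_sum]
  refine HasSum.cexp (hasSum_sum fun n hn => hasSum_sum fun χ _ => ?_)
  have hn : (1 : ℝ) ≤ n := by exact_mod_cast (Finset.mem_Icc.1 hn).1
  have hns : 1 < (n * s).re := by
    rw [← Complex.ofReal_natCast, Complex.re_ofReal_mul]
    nlinarith
  rw [logArtinL, neg_mul_neg]
  refine ((summable_logDet_frobInvariants χ.rep hns).hasSum.mul_left (b n χ)).congr_fun fun p => ?_
  rw [← mul_neg, Complex.cpow_nat_mul]

variable (Q : Nat.Primes → ℂ → ℂ) (D : Finset Nat.Primes)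

/-- The Euler factor at `p` of `∏ p ∉ D, Q p (p ^ (-s)) * ∏ n ≤ N, ∏ χ, L(n * s, χ) ^ (-b n χ)`, as
a function of `z = p ^ (-s)`. -/
def correctedFactor (p : Nat.Primes) : ℂ → ℂ :=
  localFactor ((↑D : Set Nat.Primes)ᶜ.mulIndicator Q p) b N fun χ => logDet (frobInvariants χ.rep p)

variable {Q}

theorem correctedFactor_zero (hQ0 : ∀ p, Q p 0 = 1) (p : Nat.Primes) :
    correctedFactor b N Q D p 0 = 1 := by
  refine localFactor_zero b N ?_ fun χ => logDet_zero _
  by_cases hp : p ∈ D <;> simp [hp, hQ0]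

theorem hasProd_correctedFactor {s : ℂ} (hs : 1 < s.re)
    (hQ : Multipliable fun p : {p : Nat.Primes // p ∉ D} => Q p ((p : ℂ) ^ (-s))) :
    HasProd (fun p : Nat.Primes => correctedFactor b N Q D p ((p : ℂ) ^ (-s)))
      ((∏' p : {p : Nat.Primes // p ∉ D}, Q p ((p : ℂ) ^ (-s))) *
        ∏ n ∈ Finset.Icc 1 N, ∏ χ, Complex.exp (-b n χ * logArtinL χ.rep (n * s))) := by
  have hcompl := (hasProd_subtype_iff_mulIndicator (s := (↑D : Set Nat.Primes)ᶜ)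
    (f := fun p : Nat.Primes => Q p ((p : ℂ) ^ (-s)))).1 hQ.hasProd
  refine (hcompl.mul (hasProd_exp_localExponent b N hs)).congr_fun fun p => ?_
  rw [correctedFactor, localFactor]
  by_cases hp : p ∈ D <;> simp [hp]

variable {r : ℝ} (hdiff : ∀ p, DifferentiableOn ℂ (Q p) (ball 0 r))

include hdiff in
theorem differentiableOn_correctedFactor [DecidableEq Nat.Primes] (p : Nat.Primes) :
    DifferentiableOn ℂ (correctedFactor b N Q D p) (ball 0 (if p ∈ D then 1 else min r 1)) := by
  have hlog (χ : IrrChar Gal(E/ℚ)) := differentiableOn_logDet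
    (norm_le_one_of_mem_roots_charpoly_frobInvariants χ.rep p)
  split_ifs with hp
  · refine differentiableOn_localFactor b N le_rfl ?_ hlog
    simp [hp]
  · refine differentiableOn_localFactor b N (min_le_right r 1) ?_ hlog
    simpa [hp] using (hdiff p).mono (ball_subset_ball (min_le_left r 1))

variable {b} (hQ0 : ∀ p, Q p 0 = 1) (hb : IsLogDecomposition E Q b)

include hQ0 hb in
theorem IsLogDecomposition.eventually_X_pow_dvd (hQ : ∀ p, AnalyticAt ℂ (Q p) 0) :
    ∀ᶠ p in cofinite, X ^ (N + 1) ∣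
      taylorSeries (localFactor (Q p) b N fun χ => logDet (χ.rep (frobAbove E p))) - 1 :=
  hb.mono fun p hp => X_pow_dvd_taylorSeries_localFactor_sub_one b N _ (hQ p) (hQ0 p)
    (hp _ (isFrobeniusOver_frobAbove p))

variable (hfrob : IsFrobenian E Q) (hr : 0 < r)
include hdiff hQ0 hb hfrob hr

theorem summable_taylorTail_correctedFactor {x : ℝ} (hx : 1 < x * (N + 1)) :
    Summable fun p : Nat.Primes => taylorTail (correctedFactor b N Q D p) ((p : ℝ) ^ (-x)) := by
  obtain ⟨c, -, hc⟩ := hfrob.exists_eventually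
  have hfactor : ∀ᶠ p in cofinite, correctedFactor b N Q D p =
      localFactor (Q p) b N fun χ => logDet (χ.rep (frobAbove E p)) := by
    filter_upwards [hc, D.finite_toSet.compl_mem_cofinite] with p hp hD
    simp only [correctedFactor, Set.mulIndicator_of_mem hD, logDet_frobInvariants _ hp.1]
  have hdvd := hb.eventually_X_pow_dvd N hQ0 fun p => (hdiff p).analyticAt (ball_mem_nhds 0 hr)
  refine summable_taylorTail_of_eventually_mem (Set.finite_range fun g =>
    localFactor (c g) b N fun χ => logDet (χ.rep g)) ?_ (R := min r 1) (by positivity) ?_ hx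
  · filter_upwards [hfactor, hc] with p hp hcp
    exact ⟨frobAbove E p, by rw [hp, hcp.2 _ (isFrobeniusOver_frobAbove p)]⟩
  · filter_upwards [hfactor, hdvd] with p hp hdvd
    rw [hp]
    exact ⟨differentiableOn_localFactor b N (min_le_right r 1)
      ((hdiff p).mono (ball_subset_ball (min_le_left r 1))) fun χ =>
        differentiableOn_logDet (norm_le_one_of_mem_roots_charpoly_apply χ.rep _), hdvd⟩

theorem exists_lseries_correctedFactor {ε : ℝ} (hε : 0 < ε) :
    ∃ a : ℕ → ℂ, ∀ s : ℂ, ε < s.re → LSeriesSummable a s ∧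
      HasProd (fun p : Nat.Primes => correctedFactor b ⌊1 / ε⌋₊ Q (primesLE (r ^ (-1 / ε))) p
        ((p : ℂ) ^ (-s))) (LSeries a s) := by
  classical
  set D := primesLE (r ^ (-1 / ε))
  have hzero := correctedFactor_zero b ⌊1 / ε⌋₊ D hQ0
  have hanalytic := differentiableOn_correctedFactor b ⌊1 / ε⌋₊ D hdiff
  have hradius (p : Nat.Primes) {x : ℝ} (hx : ε < x) :
      (p : ℝ) ^ (-x) < if p ∈ D then 1 else min r 1 := by
    have hone := prime_rpow_neg_lt_one p (hε.trans hx)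
    split_ifs with hp
    · exact hone
    · exact lt_min (prime_rpow_neg_lt_of_notMem_primesLE hr hε hx.le hp) hone
  have hexponent {x : ℝ} (hx : ε < x) : 1 < x * (⌊1 / ε⌋₊ + 1) :=
    calc 1 < (⌊1 / ε⌋₊ + 1) * ε := (div_lt_iff₀ hε).1 (Nat.lt_floor_add_one _)
      _ ≤ x * (⌊1 / ε⌋₊ + 1) := by rw [mul_comm]; gcongr
  have htail {x : ℝ} (hx : ε < x) :=
    summable_taylorTail_correctedFactor ⌊1 / ε⌋₊ D hdiff hQ0 hb hfrob hr (hexponent hx)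
  exact ⟨_, fun s hs => ⟨lseriesSummable_eulerCoeff_taylorSeries hzero hanalytic (hradius · hs)
    (htail hs), hasProd_eulerCoeff_taylorSeries hzero hanalytic (hradius · hs) (htail hs)⟩⟩

end DirichletSeries

section SingularityRadius

variable {Q : Nat.Primes → ℂ → ℂ} {S Γ : Nat.Primes → Set ℂ} {r : ℝ}
  (hQ : ∀ p, IsHolomorphicOnCutDisk (Q p) (S p) (Γ p))
  (hr : IsLeast ({1} ∪ {x : ℝ | ∃ p, ∃ a ∈ S p, ‖a‖ = x}) r)
include hQ hr

theorem singularity_radius_pos : 0 < r := by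
  rcases hr.1 with rfl | ⟨p, a, ha, rfl⟩
  · exact one_pos
  · exact norm_pos_iff.2 fun h => (hQ p).zero_notMem (h ▸ (hQ p).sing_subset ha)

theorem differentiableOn_ball_singularity_radius (p : Nat.Primes) :
    DifferentiableOn ℂ (Q p) (Metric.ball 0 r) := by
  refine (hQ p).differentiableOn.mono fun z hz =>
    ⟨Metric.ball_subset_ball (hr.2 (.inl rfl)) hz, fun hzΓ => ?_⟩
  obtain ⟨a, ha, haz⟩ := (hQ p).outward z hzΓ
  exact ((hr.2 (.inr ⟨p, a, ha, rfl⟩)).trans haz).not_gt (mem_ball_zero_iff.1 hz)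

end SingularityRadius

end FrobEuler

end

theorem mainTheorem4_general (E : Type*) [Field E] [NumberField E] [IsGalois ℚ E]
    (Q : Nat.Primes → ℂ → ℂ) (hfrob : FrobEuler.IsFrobenian E Q) (hQ0 : ∀ p, Q p 0 = 1)
    (r : ℝ) (hr : 0 < r) (hQ : ∀ p, DifferentiableOn ℂ (Q p) (Metric.ball 0 r)) :
    (∃ b : ℕ → FrobEuler.IrrChar Gal(E/ℚ) → ℂ, FrobEuler.IsLogDecomposition E Q b) ∧
    ∃ ℓ : FrobEuler.IrrChar Gal(E/ℚ) → ℂ → ℂ,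
      (∀ χ, FrobEuler.IsLogArtinL χ.rep (ℓ χ)) ∧
      ∀ b : ℕ → FrobEuler.IrrChar Gal(E/ℚ) → ℂ, FrobEuler.IsLogDecomposition E Q b →
      ∀ ε : ℝ, 0 < ε → ∃ a : ℕ → ℂ,
        (∀ s : ℂ, ε < s.re → LSeriesSummable a s) ∧
        DifferentiableOn ℂ (LSeries a) {s | ε < s.re} ∧
        ∀ s : ℂ, 1 < s.re → ε < s.re →
          (Summable fun p : Nat.Primes => ‖Q p ((p : ℂ) ^ (-s)) - 1‖) ∧
          (Multipliable fun p : Nat.Primes => Q p ((p : ℂ) ^ (-s))) ∧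
          (∏' p : {p : Nat.Primes // p ∉ FrobEuler.primesLE (r ^ (-1 / ε))},
              Q p ((p : ℂ) ^ (-s))) *
            ∏ n ∈ Finset.Icc 1 ⌊1 / ε⌋₊, ∏ χ, Complex.exp (-b n χ * ℓ χ (n * s)) =
            LSeries a s ∧
          ((∀ p ∈ FrobEuler.primesLE (r ^ (-1 / ε)), Q p ((p : ℂ) ^ (-s)) ≠ 0) →
            (∏' p : Nat.Primes, Q p ((p : ℂ) ^ (-s))) *
              (∏ p ∈ FrobEuler.primesLE (r ^ (-1 / ε)), (Q p ((p : ℂ) ^ (-s)))⁻¹) *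
              ∏ n ∈ Finset.Icc 1 ⌊1 / ε⌋₊, ∏ χ, Complex.exp (-b n χ * ℓ χ (n * s)) =
              LSeries a s) := by
  refine ⟨FrobEuler.exists_isLogDecomposition E hfrob hQ0, fun χ => FrobEuler.logArtinL χ.rep,
    fun χ => FrobEuler.isLogArtinL_logArtinL χ.rep, fun b hb ε hε => ?_⟩
  obtain ⟨a, ha⟩ := FrobEuler.exists_lseries_correctedFactor hQ hQ0 hb hfrob hr hε
  refine ⟨a, fun s hs => (ha s hs).1,
    FrobEuler.differentiableOn_lseries_of_summable fun s hs => (ha s hs).1, fun s hs hsε => ?_⟩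
  have hsum := hfrob.summable_norm_sub_one hQ0 hr hQ hs
  have hmul (D : Finset Nat.Primes) :
      Multipliable fun p : {p : Nat.Primes // p ∉ D} => Q p ((p : ℂ) ^ (-s)) :=
    FrobEuler.multipliable_of_summable_norm_sub_one (hsum.subtype {p | p ∉ D})
  have hremoved := (FrobEuler.hasProd_correctedFactor b _ _ hs (hmul _)).unique (ha s hsε).2
  refine ⟨hsum, FrobEuler.multipliable_of_summable_norm_sub_one hsum, hremoved, fun hne => ?_⟩
  rw [← hremoved, FrobEuler.tprod_mul_prod_inv_eq_tprod_compl (hmul _) hne]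

theorem mainTheorem4 (E : Type*) [Field E] [NumberField E] [IsGalois ℚ E]
    (Q : Nat.Primes → ℂ → ℂ) (hfrob : FrobEuler.IsFrobenian E Q)
    (S Γ : Nat.Primes → Set ℂ)
    (hQ : ∀ p, FrobEuler.IsHolomorphicOnCutDisk (Q p) (S p) (Γ p))
    (hQ0 : ∀ p, Q p 0 = 1)
    -- `r` is the smallest magnitude of a singularity, and `r = 1` if there are none
    (r : ℝ) (hr : IsLeast ({1} ∪ {x : ℝ | ∃ p, ∃ a ∈ S p, ‖a‖ = x}) r) :
    -- (i)
    (∃ b : ℕ → FrobEuler.IrrChar Gal(E/ℚ) → ℂ, FrobEuler.IsLogDecomposition E Q b) ∧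
    -- (ii)
    ∃ ℓ : FrobEuler.IrrChar Gal(E/ℚ) → ℂ → ℂ,
      (∀ χ, FrobEuler.IsLogArtinL χ.rep (ℓ χ)) ∧
      ∀ b : ℕ → FrobEuler.IrrChar Gal(E/ℚ) → ℂ, FrobEuler.IsLogDecomposition E Q b →
      ∀ ε : ℝ, 0 < ε → ∃ a : ℕ → ℂ,
        (∀ s : ℂ, ε < s.re → LSeriesSummable a s) ∧
        DifferentiableOn ℂ (LSeries a) {s | ε < s.re} ∧
        ∀ s : ℂ, 1 < s.re → ε < s.re →
          -- the Euler product converges absolutely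
          (Summable fun p : Nat.Primes => ‖Q p ((p : ℂ) ^ (-s)) - 1‖) ∧
          (Multipliable fun p : Nat.Primes => Q p ((p : ℂ) ^ (-s))) ∧
          -- the product with the factors at `p ≤ r ^ (-1/ε)` removed
          (∏' p : {p : Nat.Primes // p ∉ FrobEuler.primesLE (r ^ (-1 / ε))},
              Q p ((p : ℂ) ^ (-s))) *
            ∏ n ∈ Finset.Icc 1 ⌊1 / ε⌋₊, ∏ χ, Complex.exp (-b n χ * ℓ χ (n * s)) =
            LSeries a s ∧
          -- the same with the full product divided by these factors, where they are nonzero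
          ((∀ p ∈ FrobEuler.primesLE (r ^ (-1 / ε)), Q p ((p : ℂ) ^ (-s)) ≠ 0) →
            (∏' p : Nat.Primes, Q p ((p : ℂ) ^ (-s))) *
              (∏ p ∈ FrobEuler.primesLE (r ^ (-1 / ε)), (Q p ((p : ℂ) ^ (-s)))⁻¹) *
              ∏ n ∈ Finset.Icc 1 ⌊1 / ε⌋₊, ∏ χ, Complex.exp (-b n χ * ℓ χ (n * s)) =
              LSeries a s) :=
  mainTheorem4_general E Q hfrob hQ0 r (FrobEuler.singularity_radius_pos hQ hr)
    (FrobEuler.differentiableOn_ball_singularity_radius hQ hr)
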